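/- **Setting.** Let $\mathcal G$ be a finite causal Bayesian network (a DAG with finite real-valued nodes and a conditional distribution for every node given its parents; interventional distributions are given by truncated factorization) with a reward node $Y\in\{0,1\}$ and distinct nodes $X_1,\dots,X_M\neq Y$ with values in $\{0,1\}$, such that there is no unblocked back-door path from any $X_i$ to $Y$ (every path from $X_i$ to $Y$ that starts with an arrow into $X_i$, if there is one, contains a collider), and $p_{i,x}=\mathbb P(X_i=x)>0$ for all $i\in[M]$, $x\in\{0,1\}$. The arms are the observation $a_0=do()$, of cost $1$, and the interventions $a_{i,x}=do(X_i=x)$, of cost $\gamma\ge 1$. In each round the algorithm pulls an arm $a$ and sees a fresh independent sample from the corresponding distribution; $\mu_a$ is the expected value of $Y$ under $a$. Put $v_0=\mu_0$, $v_{i,x}=\mu_{i,x}/\gamma$, let $a^*$ maximize $v_a$, and put $\Delta_a=\mu_{a^*}-\mu_a$, $d_a=v_{a^*}-v_a$. The expected cumulative regret with budget $B$ of an algorithm is $R(B)=G_B-G(B)$, where $G(B)$ is the expected total reward it collects and $G_B$ is the maximum of this quantity over all algorithms whose total cost never exceeds $B$. **Algorithm CRM-NB-ALG** (input $B,\gamma$).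 Let $N^a_t$ be the number of pulls of $a$ in the first $t$ rounds, and $E^{i,x}_t$ the number of rounds $s\le t$ in which $a_{i,x}$ was pulled, or $a_0$ was pulled and $X_i=x$ was seen. Let $\widehat\mu_0(t)$ and $\widehat\mu_{i,x}(t)$ be the averages of $Y$ over the $N^0_t$, respectively $E^{i,x}_t$, rounds in question, and $$\overline\mu_0(t)=\widehat\mu_0(t)+\sqrt{\tfrac{8\ln t}{N^0_t}},\qquad \overline\mu_{i,x}(t)=\tfrac1\gamma\Big(\widehat\mu_{i,x}(t)+\sqrt{\tfrac{8\ln t}{E^{i,x}_t}}\Big).$$ First every arm is pulled once, and $\beta=1$. Then, in rounds $t=2M+2,2M+3,\dots$, as long as the remaining budget is at least $1$: if $N^0_{t-1}<\beta^2\ln t$ or the remaining budget is less than $\gamma$, pull $a_0$; otherwise pull an arm that maximizes $\overline\mu_a(t-1)$. After the pull, let $\widehat\mu^*=\max_{i,x}\widehat\mu_{i,x}(t)$; if $\widehat\mu_0(t)<\widehat\mu^*/\gamma$, set $\beta=\min\big(\tfrac{2\sqrt2}{\widehat\mu^*/\gamma-\widehat\mu_0(t)},\sqrt{\ln t}\big)$.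 **Theorem.** The following holds for every order of the initial pulls and every tie-breaking rule. 1. If $a_0$ is optimal, i.e. $v_a\le v_0$ for all arms $a$, then the expected cumulative regret of CRM-NB-ALG is $O(1)$: there is a constant $C$, depending on the model and $\gamma$ but not on $B$ or the tie-breaking rule, such that $|R(B)|\le C$ for all $B\ge 1+2M\gamma$ (the cost of the initial pulls). 2. There is an absolute constant $C>0$ such that, for every model and $\gamma$ for which $a_0$ is not optimal, i.e. $v_0<v_{a^*}$, there is $B_0$ (depending on the model and $\gamma$ only) with $$|R(B)|\le C\Bigg[\sum_{(i,x):\,\Delta_{i,x}>0}\Delta_{i,x}\Big(\max\Big(0,\;1+8\ln B\Big(\frac1{d_{i,x}^2}-\frac{p_{i,x}}{3d_0^2}\Big)\Big)+\frac{\pi^2}{3}\Big)+\Delta_0\Big(\frac{50\ln B}{d_0^2}+1+\frac{\pi^2}{3}\Big)\Bigg]$$ for all $B\ge B_0$. -/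

import Mathlib

open scoped BigOperators

noncomputable section

namespace CausalBandit

/-- A causal Bayesian network on a finite set `V` of nodes: a directed acyclic graph (`edge u v`
means `u → v`), for each node a finite range of real values, and for each node `v` the
conditional distribution `cpd v ω` of its value given the values `ω` of its parents. -/
structure CausalBayesNet (V : Type) [Fintype V] [DecidableEq V] where
  edge : V → V → Prop
  acyclic : ∀ v, ¬ Relation.TransGen edge v v
  range : V → Finset ℝ
  cpd : V → (V → ℝ) → ℝ → ℝ
  cpd_nonneg : ∀ v ω r, 0 ≤ cpd v ω r
  cpd_sum : ∀ v ω, ∑ r ∈ range v, cpd v ω r = 1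
  cpd_local : ∀ v ω ω', (∀ u, edge u v → ω u = ω' u) → cpd v ω = cpd v ω'

namespace CausalBayesNet

variable {V : Type} [Fintype V] [DecidableEq V]

/-- All joint assignments of values to the nodes. -/
def worlds (G : CausalBayesNet V) : Finset (V → ℝ) := Fintype.piFinset G.range

open Classical in
/-- The probability of the world `ω` under the intervention that sets the nodes of `s` to the
values `x` (truncated factorization). For `s = ∅` this is the observational distribution. -/
def doLaw (G : CausalBayesNet V) (s : Finset V) (x : V → ℝ) (ω : V → ℝ) : ℝ :=
  if ∀ v ∈ s, ω v = x v then ∏ v ∈ sᶜ, G.cpd v ω (ω v) else 0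

/-- The undirected graph underlying the network. -/
def skeleton (G : CausalBayesNet V) : SimpleGraph V := SimpleGraph.fromRel G.edge

/-- A back-door path from `x` to `y`: a path whose first edge is an arrow into `x`. -/
def IsBackdoorPath (G : CausalBayesNet V) {x y : V} (w : G.skeleton.Walk x y) : Prop :=
  w.IsPath ∧ 0 < w.length ∧ G.edge (w.getVert 1) x

/-- Some inner node of the path is a collider `→ • ←`, so that the path is blocked
(by the empty set). -/
def HasCollider (G : CausalBayesNet V) {x y : V} (w : G.skeleton.Walk x y) : Prop :=
  ∃ k, k + 2 ≤ w.length ∧ G.edge (w.getVert k) (w.getVert (k + 1)) ∧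
    G.edge (w.getVert (k + 2)) (w.getVert (k + 1))

/-- There is no unblocked back-door path from `x` to `y`. -/
def NoBackdoor (G : CausalBayesNet V) (x y : V) : Prop :=
  ∀ w : G.skeleton.Walk x y, G.IsBackdoorPath w → G.HasCollider w

end CausalBayesNet

/-- A no-backdoor bandit model: a causal Bayesian network with `M` distinct intervenable binary
nodes `X i` and a reward node `Y` with values in `{0, 1}`, without unblocked back-door paths
from any `X i` to `Y`, in which each `X i` takes both values with positive probability. -/
structure NBModel (V : Type) [Fintype V] [DecidableEq V] (M : ℕ) extends CausalBayesNet V where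
  X : Fin M → V
  Y : V
  X_injective : Function.Injective X
  X_ne_Y : ∀ i, X i ≠ Y
  range_X : ∀ i, range (X i) = {0, 1}
  range_Y : range Y ⊆ {0, 1}
  no_backdoor : ∀ i, toCausalBayesNet.NoBackdoor (X i) Y
  observable : ∀ (i : Fin M) (x : Fin 2),
    0 < ∑ ω ∈ toCausalBayesNet.worlds with ω (X i) = (x : ℝ), toCausalBayesNet.doLaw ∅ 0 ω

/-- The arms: `none` is the observation `do()`, `some (i, x)` is the intervention
`do(X i = x)`. -/
abbrev Arm (M : ℕ) : Type := Option (Fin M × Fin 2)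

/-- The observational arm. -/
abbrev obsArm {M : ℕ} : Arm M := none

/-- The arm `do(X i = x)`. -/
abbrev intArm {M : ℕ} (i : Fin M) (x : Fin 2) : Arm M := some (i, x)

/-- A history: the arms pulled so far, each with the sampled world; the latest round is the head
of the list. -/
abbrev History (V : Type) (M : ℕ) : Type := List (Arm M × (V → ℝ))

/-- A sequential algorithm: from the history it selects the next arm, or it halts (`none`). -/
abbrev Policy (V : Type) (M : ℕ) : Type := History V M → Option (Arm M)

/-- The cost of a pull: `1` for the observation and `γ` for an intervention. -/
def armCost {M : ℕ} (γ : ℝ) (a : Arm M) : ℝ := if a = obsArm then 1 else γ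

/-- The total cost of the pulls in a history. -/
def cost {V : Type} {M : ℕ} (γ : ℝ) (h : History V M) : ℝ :=
  (h.map fun e => armCost γ e.1).sum

namespace NBModel

variable {V : Type} [Fintype V] [DecidableEq V] {M : ℕ}

/-- The distribution of the world when arm `a` is pulled. -/
def law (S : NBModel V M) : Arm M → (V → ℝ) → ℝ
  | none => S.doLaw ∅ 0
  | some (i, x) => S.doLaw {S.X i} (fun _ => (x : ℝ))

/-- `p_{i,x}`, the observational probability of `X i = x`. -/
def p (S : NBModel V M) (i : Fin M) (x : Fin 2) : ℝ :=
  ∑ ω ∈ S.worlds with ω (S.X i) = (x : ℝ), S.law obsArm ω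

/-- The expected reward `μ_a` of arm `a`. -/
def mu (S : NBModel V M) (a : Arm M) : ℝ := ∑ ω ∈ S.worlds, S.law a ω * ω S.Y

/-- The expected reward per unit of cost, `v_a`. -/
def v (S : NBModel V M) (γ : ℝ) (a : Arm M) : ℝ := S.mu a / armCost γ a

/-- `Δ_a = μ_{a*} - μ_a`. -/
def Delta (S : NBModel V M) (aStar a : Arm M) : ℝ := S.mu aStar - S.mu a

/-- `d_a = v_{a*} - v_a`. -/
def d (S : NBModel V M) (γ : ℝ) (aStar a : Arm M) : ℝ := S.v γ aStar - S.v γ a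

/-! ### Running an algorithm -/

/-- The expectation of `f` at the history reached when the algorithm `π` is run from the history
`h` for `n` more rounds, or until it halts; in each round the world is drawn afresh from the
distribution of the arm pulled. -/
def expect (S : NBModel V M) (π : Policy V M) (f : History V M → ℝ) : ℕ → History V M → ℝ
  | 0, h => f h
  | n + 1, h =>
    match π h with
    | none => f h
    | some a => ∑ ω ∈ S.worlds, S.law a ω * S.expect π f n ((a, ω) :: h)

/-- The total reward collected in a history. -/
def totalReward (S : NBModel V M) (h : History V M) : ℝ := (h.map fun e => e.2 S.Y).sum

/-- The expected reward accumulated by `π` with budget `B`. A pull costs at least `1`, hence a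
run within the budget has at most `⌊B⌋` rounds. -/
def gain (S : NBModel V M) (B : ℝ) (π : Policy V M) : ℝ :=
  S.expect π S.totalReward ⌊B⌋₊ []

/-- The histories that can occur when `π` is run. -/
inductive Reachable (S : NBModel V M) (π : Policy V M) : History V M → Prop
  | nil : Reachable S π []
  | cons {h : History V M} {a : Arm M} {ω : V → ℝ} (hh : Reachable S π h) (ha : π h = some a)
      (hω : ω ∈ S.worlds) : Reachable S π ((a, ω) :: h)

/-- `π` never spends more than `B`. -/
def WithinBudget (S : NBModel V M) (γ B : ℝ) (π : Policy V M) : Prop :=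
  ∀ h, S.Reachable π h → cost γ h ≤ B

/-- `G_B`, the largest expected reward that an algorithm can accumulate with budget `B`. -/
def optGain (S : NBModel V M) (γ B : ℝ) : ℝ :=
  sSup {g | ∃ π : Policy V M, S.WithinBudget γ B π ∧ g = S.gain B π}

/-- The expected cumulative regret of `π` with budget `B`. -/
def regret (S : NBModel V M) (γ B : ℝ) (π : Policy V M) : ℝ := S.optGain γ B - S.gain B π

/-! ### The algorithm -/

/-- The rounds that give a sample for arm `a`: those in which `a` was pulled and, for
`a = do(X i = x)`, also those in which the observational arm was pulled and `X i = x` was seen. -/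
def IsSample (S : NBModel V M) : Arm M → Arm M × (V → ℝ) → Prop
  | none, e => e.1 = obsArm
  | some (i, x), e => e.1 = intArm i x ∨ (e.1 = obsArm ∧ e.2 (S.X i) = (x : ℝ))

open Classical in
/-- The effective number of pulls of `a`: `N^0` for the observational arm and `E^{i,x}` for
`do(X i = x)`. -/
def effPulls (S : NBModel V M) (a : Arm M) (h : History V M) : ℕ :=
  (h.filter fun e => S.IsSample a e).length

open Classical in
/-- The empirical estimate of `μ_a`. -/
def muHat (S : NBModel V M) (a : Arm M) (h : History V M) : ℝ :=
  ((h.filter fun e => S.IsSample a e).map fun e => e.2 S.Y).sum / S.effPulls a h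

/-- The weighted upper confidence estimate of arm `a` after the `t = h.length` rounds of `h`. -/
def ucb (S : NBModel V M) (γ : ℝ) (a : Arm M) (h : History V M) : ℝ :=
  (S.muHat a h + √(8 * Real.log h.length / S.effPulls a h)) / armCost γ a

/-- The largest empirical estimate among the interventions. -/
def muHatMax (S : NBModel V M) (h : History V M) : ℝ :=
  ⨆ ix : Fin M × Fin 2, S.muHat (intArm ix.1 ix.2) h

open Classical in
/-- The value of `β` after the rounds of a history: it is `1` after the `2M + 1` initial pulls,
and is updated at the end of every later round `t` in which `μ̂_0(t) < μ̂*(t) / γ`. -/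
def beta (S : NBModel V M) (γ : ℝ) : History V M → ℝ
  | [] => 1
  | e :: h =>
    if 2 * M + 2 ≤ (e :: h).length ∧ S.muHat obsArm (e :: h) < S.muHatMax (e :: h) / γ then
      min (2 * √2 / (S.muHatMax (e :: h) / γ - S.muHat obsArm (e :: h)))
        √(Real.log (e :: h).length)
    else S.beta γ h

open Classical in
/-- `CRM-NB-ALG` with budget `B` and cost `γ`. First each arm is pulled once. Then, while the
remaining budget is at least `1`, the algorithm pulls in round `t = h.length + 1` the observational
arm if `N^0 < β² log t` or if the remaining budget is below `γ`, and otherwise an arm with the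
largest weighted upper confidence estimate. The function `tie` fixes the order of the initial pulls
and breaks the ties of the maximum. -/
def crmNB (S : NBModel V M) (γ B : ℝ) (tie : History V M → Finset (Arm M) → Arm M) :
    Policy V M := fun h =>
  let unpulled : Finset (Arm M) := Finset.univ.filter fun a => ∀ e ∈ h, e.1 ≠ a
  if unpulled.Nonempty then some (tie h unpulled)
  else if B - cost γ h < 1 then none
  else if (S.effPulls obsArm h : ℝ) < S.beta γ h ^ 2 * Real.log (h.length + 1) ∨
      B - cost γ h < γ then some obsArm
  else some (tie h (Finset.univ.filter fun a => ∀ a', S.ucb γ a' h ≤ S.ucb γ a h))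

open Classical in
/-- The regret bound for a model in which the optimal arm `aStar` is an intervention. -/
def regretBound (S : NBModel V M) (γ : ℝ) (aStar : Arm M) (B : ℝ) : ℝ :=
  (∑ ix : Fin M × Fin 2 with 0 < S.Delta aStar (intArm ix.1 ix.2),
      S.Delta aStar (intArm ix.1 ix.2) *
        (max 0 (1 + 8 * Real.log B *
            (1 / S.d γ aStar (intArm ix.1 ix.2) ^ 2 -
              S.p ix.1 ix.2 / (3 * S.d γ aStar obsArm ^ 2))) + Real.pi ^ 2 / 3)) +
    S.Delta aStar obsArm *
      (50 * Real.log B / S.d γ aStar obsArm ^ 2 + 1 + Real.pi ^ 2 / 3)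

end NBModel

/-- `tie` is a selection rule: from a nonempty set of arms it selects one of its elements. -/
def IsSelection {V : Type} {M : ℕ} (tie : History V M → Finset (Arm M) → Arm M) : Prop :=
  ∀ (h : History V M) (s : Finset (Arm M)), s.Nonempty → tie h s ∈ s

end CausalBandit

end

open scoped BigOperators

noncomputable section


namespace CausalBandit

namespace CausalBayesNet

variable {V : Type} [Fintype V] [DecidableEq V] (G : CausalBayesNet V)

open Relation

/-! ### Blocked paths and ancestors -/

/-! No admissible algorithm earns more than v_{a*}·B. A run of CRM-NB-ALG leaves less than one unit
of budget unspent and loses cost·d_a for each pull of an arm a. The regret is therefore controlled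
by the expected numbers of pulls of suboptimal arms (`abs_regret_le`).

Observations inform about interventions because of the back-door criterion. The strict ancestors of
X_i are disjoint from the nodes that reach Y while avoiding X_i, so conditioning on X_i = x and
intervening give the same mean of Y (`sum_doLaw_empty_eq_mul`). An observational round with X_i = x
is thus a genuine sample for do(X_i = x). An exponential supermartingale gives Hoeffding's
inequality for the first n samples of an arm under any adaptive rule
(`SamplesOf.expect_ind_deviates_le`). A union bound makes the event of an inaccurate estimate
between times s/2 and s cost O(1/s²), so inaccurate late rounds contribute O(1) in total.

With accurate estimates, an index maximizer a has at most 18 log t / (cost·d_a)² samples, and at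
most 9γ² times as many as an optimal arm. Forced observations number only O(log² t), so the second
bound makes the sample count of an optimal arm grow linearly (`exists_linear_growth`). If a_0 is
optimal, every event X_i = x is then seen linearly often, which eventually exceeds the logarithmic
quota of a suboptimal arm: O(1) pulls.

If an intervention is optimal, put δ = d_0. After 32 log B / δ² observations the estimated gap is at
least δ/2, hence β² ≤ 32/δ², and neither exploration nor the index asks for more. Conversely β ≥ 1
forces log t observations. These make all estimates consistent, which raises β² above 7/δ², so X_j =
z is seen at least 6 p_{j,z} log t / δ² times. Subtracted from the quota 18 log t / d², this leaves
18 log B·(1/d² − p/(3δ²))₊ pulls. The exceptional event here has arbitrarily small fixed weight and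
costs η log B. For large B this and all constants fit into the term with 50 log B. -/

theorem edge_asymm {u v : V} (h : G.edge u v) : ¬ G.edge v u := fun h' =>
  G.acyclic u ((TransGen.single h).tail h')

theorem adj_of_edge {u v : V} (h : G.edge u v) : G.skeleton.Adj u v := by
  refine (SimpleGraph.fromRel_adj _ _ _).2 ⟨?_, Or.inl h⟩
  rintro rfl
  exact G.acyclic _ (TransGen.single h)

/-- The edges of the walk point backwards up to some position, and forwards afterwards. -/
def IsFork {x y : V} (w : G.skeleton.Walk x y) : Prop :=
  ∃ m, ∀ k < w.length, (k < m → G.edge (w.getVert (k + 1)) (w.getVert k)) ∧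
    (m ≤ k → G.edge (w.getVert k) (w.getVert (k + 1)))

variable {G}

theorem IsFork.not_hasCollider {x y : V} {w : G.skeleton.Walk x y} (hw : G.IsFork w) :
    ¬ G.HasCollider w := by
  rintro ⟨k, hk, h1, h2⟩
  obtain ⟨m, hm⟩ := hw
  by_cases hkm : k < m
  · exact G.edge_asymm h1 ((hm k (by omega)).1 hkm)
  · exact G.edge_asymm h2 ((hm (k + 1) (by omega)).2 (by omega))

/-- Acyclicity makes directed walks into paths: all later vertices are descendants of the start, so
meeting the start again would close a cycle. The support clause carries this invariant and is reused
in `NoBackdoor.not_ancestor`. -/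
theorem exists_directed_path {u y : V} (h : ReflTransGen G.edge u y) :
    ∃ w : G.skeleton.Walk u y, w.IsPath ∧
      (∀ k < w.length, G.edge (w.getVert k) (w.getVert (k + 1))) ∧
      ∀ z ∈ w.support, ReflTransGen G.edge u z := by
  induction h using ReflTransGen.head_induction_on with
  | refl =>
    refine ⟨SimpleGraph.Walk.nil, by simp, by simp, ?_⟩
    intro z hz
    simp only [SimpleGraph.Walk.support_nil, List.mem_singleton] at hz
    subst hz
    exact .refl
  | head huc _ ih =>
    obtain ⟨w, hp, hd, hs⟩ := ih
    refine ⟨SimpleGraph.Walk.cons (G.adj_of_edge huc) w, ?_, ?_, ?_⟩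
    · rw [SimpleGraph.Walk.cons_isPath_iff]
      exact ⟨hp, fun hu => G.acyclic _ (TransGen.head' huc (hs _ hu))⟩
    · rintro (_ | k) hk
      · simpa using huc
      · simpa using hd k (by simpa using hk)
    · intro z hz
      rw [SimpleGraph.Walk.support_cons, List.mem_cons] at hz
      rcases hz with rfl | hz
      · exact .refl
      · exact ReflTransGen.head huc (hs z hz)

theorem isFork_cons {u u' y : V} (h : G.edge u u') {w : G.skeleton.Walk u y} (hw : G.IsFork w) :
    G.IsFork (SimpleGraph.Walk.cons (G.adj_of_edge h).symm w) := by
  obtain ⟨m, hm⟩ := hw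
  refine ⟨m + 1, ?_⟩
  rintro (_ | k) hk
  · simpa using h
  · have := hm k (by simpa using hk)
    simpa using this

/-- Prepending the arrows of z → … → u in reverse keeps the walk a fork. It stays a path: a repeated
vertex would be an ancestor of the previous start, which gives a cycle, or a non-ancestor of x,
whereas each new vertex is an ancestor of x. -/
theorem exists_fork_path {x y z u : V} {w : G.skeleton.Walk z y} (hp : w.IsPath)
    (hf : G.IsFork w) (hs : ∀ t ∈ w.support, t = z ∨ ¬ ReflTransGen G.edge t x)
    (hzu : ReflTransGen G.edge z u) (hux : ReflTransGen G.edge u x) :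
    ∃ w' : G.skeleton.Walk u y, w'.IsPath ∧ G.IsFork w' ∧
      ∀ t ∈ w'.support, ReflTransGen G.edge t u ∨ ¬ ReflTransGen G.edge t x := by
  induction hzu with
  | refl =>
    refine ⟨w, hp, hf, fun t ht => ?_⟩
    rcases hs t ht with rfl | h
    · exact Or.inl .refl
    · exact Or.inr h
  | tail _ hbc ih =>
    obtain ⟨w', hp', hf', hs'⟩ := ih (ReflTransGen.head hbc hux)
    refine ⟨SimpleGraph.Walk.cons (G.adj_of_edge hbc).symm w', ?_, isFork_cons hbc hf', ?_⟩
    · rw [SimpleGraph.Walk.cons_isPath_iff]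
      refine ⟨hp', fun hc => ?_⟩
      rcases hs' _ hc with h | h
      · exact G.acyclic _ (TransGen.head' hbc h)
      · exact h hux
    · intro t ht
      rw [SimpleGraph.Walk.support_cons, List.mem_cons] at ht
      rcases ht with rfl | ht
      · exact Or.inl .refl
      · exact (hs' t ht).imp_left fun h => h.tail hbc

/-- Without unblocked back-door paths from `x` to `y`, a strict ancestor of `x` reaches `y`
only through `x`. -/
theorem NoBackdoor.not_ancestor {x y : V} (hxy : G.NoBackdoor x y) {u : V}
    (hu : ReflTransGen (fun a b => G.edge a b ∧ b ≠ x) u y) : ¬ TransGen G.edge u x := by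
  -- From a strict ancestor z of x, such a fork extends backwards along z → … → b → x. The result is
  -- a path from x to y that begins with an arrow into x and is again a fork, hence an unblocked
  -- back-door path.
  have key : ∀ z, TransGen G.edge z x → ∀ w : G.skeleton.Walk z y, w.IsPath →
      G.IsFork w → (∀ t ∈ w.support, t = z ∨ ¬ ReflTransGen G.edge t x) → False := by
    intro z hz w hp hf hs
    obtain ⟨b, hzb, hbx⟩ := TransGen.tail'_iff.1 hz
    obtain ⟨w', hp', hf', hs'⟩ := exists_fork_path hp hf hs hzb (ReflTransGen.single hbx)
    have hf2 := isFork_cons hbx hf'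
    refine hf2.not_hasCollider (hxy _ ⟨?_, by simp, by simpa using hbx⟩)
    rw [SimpleGraph.Walk.cons_isPath_iff]
    refine ⟨hp', fun hc => ?_⟩
    rcases hs' _ hc with h | h
    · exact G.acyclic _ (TransGen.head' hbx h)
    · exact h .refl
  induction hu using ReflTransGen.head_induction_on with
  | refl =>
    intro h
    exact key y h SimpleGraph.Walk.nil (by simp) ⟨0, by simp⟩ (by simp)
  | @head u c huc hcy ih =>
    intro h
    -- As c ≠ x, failing to be a strict ancestor of x means not being an ancestor at all. Then no
    -- descendant of c is one either, so the directed path from c to y meets the support condition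
    -- of `key`.
    have hcx : ¬ ReflTransGen G.edge c x := fun hc => by
      rcases reflTransGen_iff_eq_or_transGen.1 hc with rfl | hc
      · exact huc.2 rfl
      · exact ih hc
    obtain ⟨w, hp, hd, hs⟩ := exists_directed_path
      (ReflTransGen.mono (fun _ _ h => h.1) _ _ hcy)
    refine key u h (SimpleGraph.Walk.cons (G.adj_of_edge huc.1) w) ?_ ⟨0, ?_⟩ ?_
    · rw [SimpleGraph.Walk.cons_isPath_iff]
      exact ⟨hp, fun hu => G.acyclic _ (TransGen.head' huc.1 (hs _ hu))⟩
    · rintro (_ | k) hk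
      · simpa using huc.1
      · simpa using hd k (by simpa using hk)
    · intro t ht
      rw [SimpleGraph.Walk.support_cons, List.mem_cons] at ht
      exact ht.imp_right fun ht h' => hcx ((hs t ht).trans h')

/-! ### Summing out nodes -/

variable (G)

theorem range_card_pos (v : V) : 0 < (G.range v).card := by
  rw [Finset.card_pos, Finset.nonempty_iff_ne_empty]
  intro h
  have := G.cpd_sum v 0
  simp [h] at this

theorem mem_worlds {ω : V → ℝ} : ω ∈ G.worlds ↔ ∀ v, ω v ∈ G.range v := Fintype.mem_piFinset

theorem card_worlds : (G.worlds.card : ℝ) = ∏ v, ((G.range v).card : ℝ) := by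
  simp [worlds, Fintype.card_piFinset]

/-- The map (ω, r) ↦ (ω with value r at v, ω v) is an involution of worlds × range v. This is the
device for summing out a single node. -/
theorem sum_update (v : V) (g : (V → ℝ) → ℝ) :
    ∑ ω ∈ G.worlds, ∑ r ∈ G.range v, g (Function.update ω v r) =
      (G.range v).card * ∑ ω ∈ G.worlds, g ω := by
  rw [← Finset.sum_product', Finset.mul_sum]
  have : ∀ ω ∈ G.worlds, ((G.range v).card : ℝ) * g ω = ∑ r ∈ G.range v, g ω := by
    intro ω _
    simp
  rw [Finset.sum_congr rfl this, ← Finset.sum_product']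
  refine Finset.sum_bij' (fun q _ => (Function.update q.1 v q.2, q.1 v))
    (fun q _ => (Function.update q.1 v q.2, q.1 v)) ?_ ?_ ?_ ?_ ?_
  · rintro ⟨ω, r⟩ h
    simp only [Finset.mem_product, mem_worlds] at h ⊢
    refine ⟨fun u => ?_, h.1 v⟩
    by_cases hu : u = v
    · subst hu; simpa using h.2
    · simpa [hu] using h.1 u
  · rintro ⟨ω, r⟩ h
    simp only [Finset.mem_product, mem_worlds] at h ⊢
    refine ⟨fun u => ?_, h.1 v⟩
    by_cases hu : u = v
    · subst hu; simpa using h.2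
    · simpa [hu] using h.1 u
  · rintro ⟨ω, r⟩ h; simp
  · rintro ⟨ω, r⟩ h; simp
  · rintro ⟨ω, r⟩ h; simp

theorem exists_sink {W : Finset V} (hW : W.Nonempty) : ∃ v ∈ W, ∀ u ∈ W, ¬ G.edge v u := by
  let r : V → V → Prop := fun a b => TransGen G.edge b a
  have : IsTrans V r := ⟨fun a b c h1 h2 => TransGen.trans h2 h1⟩
  have : Std.Irrefl r := ⟨fun a h => G.acyclic a h⟩
  have hwf : WellFounded r := Finite.wellFounded_of_trans_of_irrefl r
  obtain ⟨v, hv, hmin⟩ := hwf.has_min (W : Set V) hW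
  exact ⟨v, hv, fun u hu h => hmin u hu (TransGen.single h)⟩

theorem cpd_congr {v : V} {ω ω' : V → ℝ} (h : ∀ u, G.edge u v → ω u = ω' u)
    (hv : ω v = ω' v) : G.cpd v ω (ω v) = G.cpd v ω' (ω' v) := by
  rw [G.cpd_local v ω ω' h, hv]

/-- Nodes of W are summed out one at a time, always a sink of what remains: its own factor is the
only one that sees its value, and this factor sums to 1. The cardinalities appear because the right
side also runs over the coordinates in W, which `f` ignores. -/
theorem sum_mul_prod_cpd (W : Finset V) (f : (V → ℝ) → ℝ)
    (hf : ∀ ω ω', (∀ v ∉ W, ω v = ω' v) → f ω = f ω') :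
    (∏ v ∈ W, ((G.range v).card : ℝ)) * ∑ ω ∈ G.worlds, f ω * ∏ v ∈ W, G.cpd v ω (ω v) =
      ∑ ω ∈ G.worlds, f ω := by
  induction hn : W.card generalizing W with
  | zero =>
    rw [Finset.card_eq_zero] at hn
    subst hn
    simp
  | succ n ih =>
    obtain ⟨v, hv, hsink⟩ := G.exists_sink (Finset.card_pos.1 (by omega : 0 < W.card))
    have ih' := ih (W.erase v) (fun ω ω' h => hf ω ω' fun u hu => h u fun h' =>
      hu (Finset.mem_of_mem_erase h')) (by rw [Finset.card_erase_of_mem hv, hn]; rfl)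
    rw [← ih', ← Finset.mul_prod_erase W _ hv, mul_comm ((G.range v).card : ℝ), mul_assoc,
      ← G.sum_update v]
    congr 1
    refine Finset.sum_congr rfl fun ω _ => ?_
    have : ∀ r ∈ G.range v, f (Function.update ω v r) *
        ∏ u ∈ W, G.cpd u (Function.update ω v r) (Function.update ω v r u) =
        (f ω * ∏ u ∈ W.erase v, G.cpd u ω (ω u)) * G.cpd v ω r := by
      intro r _
      rw [← Finset.mul_prod_erase W _ hv]
      have h1 : f (Function.update ω v r) = f ω := hf _ _ fun u hu => by
        have : u ≠ v := fun h => hu (h ▸ hv)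
        simp [this]
      have h2 : G.cpd v (Function.update ω v r) (Function.update ω v r v) = G.cpd v ω r := by
        rw [Function.update_self]
        refine congrFun (G.cpd_local _ _ _ fun u hu => ?_) _
        have : u ≠ v := by
          rintro rfl
          exact G.acyclic _ (TransGen.single hu)
        simp [this]
      have h3 : ∏ u ∈ W.erase v, G.cpd u (Function.update ω v r) (Function.update ω v r u) =
          ∏ u ∈ W.erase v, G.cpd u ω (ω u) := by
        refine Finset.prod_congr rfl fun u hu => ?_
        rw [Finset.mem_erase] at hu
        refine G.cpd_congr (fun t ht => ?_) (by simp [hu.1])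
        have : t ≠ v := by
          rintro rfl
          exact hsink u hu.2 ht
        simp [this]
      rw [h1, h2, h3]
      ring
    rw [Finset.sum_congr rfl this, ← Finset.mul_sum, G.cpd_sum, mul_one]

theorem card_mul_sum_ite (v : V) {x : ℝ} (hx : x ∈ G.range v) :
    ((G.range v).card : ℝ) * ∑ ω ∈ G.worlds, (if ω v = x then (1 : ℝ) else 0) =
      G.worlds.card := by
  rw [← G.sum_update v]
  simp [hx]

/-! ### Interventional laws and the back-door criterion -/

theorem doLaw_nonneg (s : Finset V) (x ω : V → ℝ) : 0 ≤ G.doLaw s x ω := by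
  unfold doLaw
  split_ifs
  · exact Finset.prod_nonneg fun v _ => G.cpd_nonneg _ _ _
  · exact le_rfl

theorem doLaw_empty (x ω : V → ℝ) : G.doLaw ∅ x ω = ∏ v, G.cpd v ω (ω v) := by
  simp [doLaw]

theorem doLaw_singleton (u : V) (x ω : V → ℝ) :
    G.doLaw {u} x ω = (if ω u = x u then 1 else 0) * ∏ v ∈ {u}ᶜ, G.cpd v ω (ω v) := by
  simp [doLaw]

theorem prod_card_ne_zero (W : Finset V) : (∏ v ∈ W, ((G.range v).card : ℝ)) ≠ 0 :=
  Finset.prod_ne_zero_iff.2 fun v _ => by exact_mod_cast (G.range_card_pos v).ne'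

theorem sum_doLaw_empty (x : V → ℝ) : ∑ ω ∈ G.worlds, G.doLaw ∅ x ω = 1 := by
  have h := G.sum_mul_prod_cpd Finset.univ (fun _ => 1) (fun _ _ _ => rfl)
  simp only [one_mul, Finset.sum_const, nsmul_eq_mul, mul_one, G.card_worlds] at h
  simp only [doLaw_empty]
  exact mul_left_cancel₀ (G.prod_card_ne_zero Finset.univ) (by rw [h, mul_one])

theorem sum_doLaw_singleton (u : V) (x : V → ℝ) (hx : x u ∈ G.range u) :
    ∑ ω ∈ G.worlds, G.doLaw {u} x ω = 1 := by
  have h := G.sum_mul_prod_cpd {u}ᶜ (fun ω => if ω u = x u then 1 else 0)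
    (fun ω ω' h => by simp [h u (by simp)])
  have h2 := G.card_mul_sum_ite u hx
  rw [← h, G.card_worlds, ← Finset.prod_mul_prod_compl {u}, Finset.prod_singleton] at h2
  simp only [doLaw_singleton]
  have h3 := mul_left_cancel₀ (by exact_mod_cast (G.range_card_pos u).ne') h2
  exact mul_left_cancel₀ (G.prod_card_ne_zero {u}ᶜ) (by rw [h3, mul_one])

/-- Exchanging the coordinates in `D` of two independent uniformly distributed worlds. -/
theorem sum_mul_sum_swap (D : Finset V) (f g f' g' : (V → ℝ) → ℝ)
    (h : ∀ ω ω', f ω * g ω' = f' (D.piecewise ω' ω) * g' (D.piecewise ω ω')) :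
    (∑ ω ∈ G.worlds, f ω) * ∑ ω ∈ G.worlds, g ω =
      (∑ ω ∈ G.worlds, f' ω) * ∑ ω ∈ G.worlds, g' ω := by
  rw [Finset.sum_mul_sum, Finset.sum_mul_sum, ← Finset.sum_product', ← Finset.sum_product']
  refine Finset.sum_bij' (fun q _ => (D.piecewise q.2 q.1, D.piecewise q.1 q.2))
    (fun q _ => (D.piecewise q.2 q.1, D.piecewise q.1 q.2)) ?_ ?_ ?_ ?_ ?_
  · rintro ⟨ω, ω'⟩ hq
    simp only [Finset.mem_product, mem_worlds] at hq ⊢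
    constructor <;> intro v <;> by_cases hv : v ∈ D <;> simp [hv, hq.1 v, hq.2 v]
  · rintro ⟨ω, ω'⟩ hq
    simp only [Finset.mem_product, mem_worlds] at hq ⊢
    constructor <;> intro v <;> by_cases hv : v ∈ D <;> simp [hv, hq.1 v, hq.2 v]
  · rintro ⟨ω, ω'⟩ _
    ext v <;> by_cases hv : v ∈ D <;> simp [hv]
  · rintro ⟨ω, ω'⟩ _
    ext v <;> by_cases hv : v ∈ D <;> simp [hv]
  · rintro ⟨ω, ω'⟩ _
    exact h ω ω'

open Classical in
/-- The back-door criterion with an empty adjustment set: without unblocked back-door paths,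
conditioning on `u = x` and intervening by `do(u = x)` give the same mean of `y`. -/
theorem sum_doLaw_empty_eq_mul {u y : V} (huy : u ≠ y) (hnb : G.NoBackdoor u y) {x : ℝ}
    (hx : x ∈ G.range u) :
    ∑ ω ∈ G.worlds with ω u = x, G.doLaw ∅ 0 ω * ω y =
      (∑ ω ∈ G.worlds with ω u = x, G.doLaw ∅ 0 ω) *
        ∑ ω ∈ G.worlds, G.doLaw {u} (fun _ => x) ω * ω y := by
  -- Parents of u and of A lie in A, and parents of D lie in D or equal u. So the weight of `insert
  -- u A` ignores D, that of D sees only u and D, and all other nodes can be summed out. The clause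
  -- v ≠ u is needed because the relation restricts only the heads of the arrows.
  set A : Finset V := Finset.univ.filter fun v => TransGen G.edge v u with hA
  set D : Finset V := Finset.univ.filter fun v =>
    ReflTransGen (fun a b => G.edge a b ∧ b ≠ u) v y ∧ v ≠ u with hD
  have memA : ∀ v, v ∈ A ↔ TransGen G.edge v u := fun v => by simp [hA]
  have memD : ∀ v, v ∈ D ↔ ReflTransGen (fun a b => G.edge a b ∧ b ≠ u) v y ∧ v ≠ u :=
    fun v => by simp [hD]
  have huA : u ∉ A := fun h => G.acyclic u ((memA u).1 h)
  have huD : u ∉ D := fun h => ((memD u).1 h).2 rfl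
  have hyD : y ∈ D := (memD y).2 ⟨.refl, huy.symm⟩
  have hAD : Disjoint A D := by
    rw [Finset.disjoint_left]
    intro v hv hv'
    exact hnb.not_ancestor ((memD v).1 hv').1 ((memA v).1 hv)
  have parA : ∀ v ∈ insert u A, ∀ t, G.edge t v → t ∈ A := by
    intro v hv t ht
    rw [Finset.mem_insert] at hv
    rcases hv with rfl | hv
    · exact (memA t).2 (TransGen.single ht)
    · exact (memA t).2 (TransGen.head ht ((memA v).1 hv))
  have parD : ∀ v ∈ D, ∀ t, G.edge t v → t = u ∨ t ∈ D := by
    intro v hv t ht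
    by_cases htu : t = u
    · exact Or.inl htu
    · exact Or.inr ((memD t).2 ⟨ReflTransGen.head ⟨ht, ((memD v).1 hv).2⟩ ((memD v).1 hv).1, htu⟩)
  set R : Finset V := (insert u A ∪ D)ᶜ with hR
  set F : (V → ℝ) → ℝ := fun ω => ∏ v ∈ insert u A, G.cpd v ω (ω v) with hF
  set K : (V → ℝ) → ℝ := fun ω => ∏ v ∈ D, G.cpd v ω (ω v) with hK
  set I : (V → ℝ) → ℝ := fun ω => if ω u = x then 1 else 0 with hI
  have hFc : ∀ ω ω', (∀ v ∈ insert u A, ω v = ω' v) → F ω = F ω' := fun ω ω' h =>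
    Finset.prod_congr rfl fun v hv => G.cpd_congr
      (fun t ht => h t (Finset.mem_insert_of_mem (parA v hv t ht))) (h v hv)
  have hKc : ∀ ω ω', ω u = ω' u → (∀ v ∈ D, ω v = ω' v) → K ω = K ω' := fun ω ω' hu h =>
    Finset.prod_congr rfl fun v hv => G.cpd_congr
      (fun t ht => (parD v hv t ht).elim (fun e => e ▸ hu) (h t)) (h v hv)
  have hIc : ∀ ω ω', ω u = ω' u → I ω = I ω' := fun ω ω' h => by simp [hI, h]
  have hdisj : Disjoint (insert u A) D := by
    rw [Finset.disjoint_insert_left]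
    exact ⟨huD, hAD⟩
  have hall : ∀ ω : V → ℝ, ∏ v, G.cpd v ω (ω v) = F ω * K ω * ∏ v ∈ R, G.cpd v ω (ω v) := by
    intro ω
    rw [← Finset.prod_union hdisj, hR, Finset.prod_mul_prod_compl]
  have memR : ∀ v, v ∈ R ↔ v ≠ u ∧ v ∉ A ∧ v ∉ D := by
    intro v
    simp [hR]
  -- the joint weight
  have e1 : (∏ v ∈ R, ((G.range v).card : ℝ)) *
      ∑ ω ∈ G.worlds with ω u = x, G.doLaw ∅ 0 ω * ω y =
      ∑ ω ∈ G.worlds, I ω * F ω * K ω * ω y := by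
    rw [← G.sum_mul_prod_cpd R (fun ω => I ω * F ω * K ω * ω y), Finset.sum_filter]
    · congr 1
      refine Finset.sum_congr rfl fun ω _ => ?_
      rw [doLaw_empty, hall]
      by_cases h : ω u = x
      · simp only [hI, if_pos h]
        ring
      · simp only [hI, if_neg h]
        ring
    · intro ω ω' h
      have h' : ∀ v, (v = u ∨ v ∈ A ∨ v ∈ D) → ω v = ω' v := fun v hv => h v (by
        rw [memR]; tauto)
      rw [hIc ω ω' (h' u (by tauto)), h' y (by tauto),
        hFc ω ω' (fun v hv => h' v (by rw [Finset.mem_insert] at hv; tauto)),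
        hKc ω ω' (h' u (by tauto)) (fun v hv => h' v (by tauto))]
  have hRD : Disjoint R D := by
    rw [Finset.disjoint_left]
    intro v hv
    exact ((memR v).1 hv).2.2
  have hRA : Disjoint R A := by
    rw [Finset.disjoint_left]
    intro v hv
    exact ((memR v).1 hv).2.1
  have e2 : ((∏ v ∈ R, ((G.range v).card : ℝ)) * ∏ v ∈ D, ((G.range v).card : ℝ)) *
      ∑ ω ∈ G.worlds with ω u = x, G.doLaw ∅ 0 ω = ∑ ω ∈ G.worlds, I ω * F ω := by
    rw [← Finset.prod_union hRD, ← G.sum_mul_prod_cpd (R ∪ D) (fun ω => I ω * F ω),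
      Finset.sum_filter]
    · congr 1
      refine Finset.sum_congr rfl fun ω _ => ?_
      rw [doLaw_empty, hall, Finset.prod_union hRD]
      by_cases h : ω u = x
      · simp only [hI, hK, if_pos h]
        ring
      · simp only [hI, if_neg h]
        ring
    · intro ω ω' h
      have h' : ∀ v, v = u ∨ v ∈ A → ω v = ω' v := fun v hv => h v (by
        rw [Finset.mem_union, memR]
        rintro (h1 | h1)
        · tauto
        · rcases hv with rfl | hv
          · exact huD h1
          · exact Finset.disjoint_left.1 hAD hv h1)
      rw [hIc ω ω' (h' u (by tauto)),
        hFc ω ω' (fun v hv => h' v (by rw [Finset.mem_insert] at hv; tauto))]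
  have hcompl : ({u}ᶜ : Finset V) = (R ∪ A) ∪ D := by
    ext v
    simp only [Finset.mem_compl, Finset.mem_singleton, Finset.mem_union, memR]
    constructor
    · tauto
    · rintro ((h | h) | h)
      · exact h.1
      · rintro rfl; exact huA h
      · rintro rfl; exact huD h
  have hRAD : Disjoint (R ∪ A) D := Finset.disjoint_union_left.2 ⟨hRD, hAD⟩
  have e3 : ((∏ v ∈ R, ((G.range v).card : ℝ)) * ∏ v ∈ A, ((G.range v).card : ℝ)) *
      ∑ ω ∈ G.worlds, G.doLaw {u} (fun _ => x) ω * ω y =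
      ∑ ω ∈ G.worlds, I ω * K ω * ω y := by
    rw [← Finset.prod_union hRA, ← G.sum_mul_prod_cpd (R ∪ A) (fun ω => I ω * K ω * ω y)]
    · congr 1
      refine Finset.sum_congr rfl fun ω _ => ?_
      rw [doLaw_singleton, hcompl, Finset.prod_union hRAD]
      simp only [hI, hK]
      ring
    · intro ω ω' h
      have h' : ∀ v, v = u ∨ v ∈ D → ω v = ω' v := fun v hv => h v (by
        rw [Finset.mem_union, memR]
        rintro (h1 | h1)
        · tauto
        · rcases hv with rfl | hv
          · exact huA h1
          · exact Finset.disjoint_left.1 hAD h1 hv)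
      rw [hIc ω ω' (h' u (by tauto)), h' y (by tauto),
        hKc ω ω' (h' u (by tauto)) (fun v hv => h' v (by tauto))]
  -- For two worlds with u = x, exchanging the D-coordinates moves the factor `K` and the value of y
  -- from one world to the other. This is the independence of A and D given u = x; what is left
  -- behind counts the worlds with u = x.
  have e4 := G.sum_mul_sum_swap D (fun ω => I ω * F ω) (fun ω => I ω * K ω * ω y)
    (fun ω => I ω * F ω * K ω * ω y) I (by
      intro ω ω'
      have i1 : I (D.piecewise ω' ω) = I ω := hIc _ _ (by simp [huD])
      have i2 : I (D.piecewise ω ω') = I ω' := hIc _ _ (by simp [huD])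
      have i3 : F (D.piecewise ω' ω) = F ω := hFc _ _ fun v hv => by
        simp [Finset.disjoint_left.1 hdisj hv]
      have i4 : (D.piecewise ω' ω) y = ω' y := by simp [hyD]
      rw [i1, i2, i3, i4]
      by_cases h1 : ω u = x
      · by_cases h2 : ω' u = x
        · rw [hKc (D.piecewise ω' ω) ω' (by simp [huD, h1, h2]) (fun v hv => by simp [hv])]
          ring
        · simp [hI, h2]
      · simp [hI, h1])
  have e5 := G.card_mul_sum_ite u hx
  rw [G.card_worlds, ← Finset.prod_mul_prod_compl {u}, Finset.prod_singleton, hcompl,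
    Finset.prod_union hRAD, Finset.prod_union hRA] at e5
  have e6 := mul_left_cancel₀ (by exact_mod_cast (G.range_card_pos u).ne') e5
  rw [← e1, ← e2, ← e3, e6] at e4
  have n1 := G.prod_card_ne_zero R
  have n2 := G.prod_card_ne_zero A
  have n3 := G.prod_card_ne_zero D
  refine mul_left_cancel₀ (mul_ne_zero (mul_ne_zero n1 n1) (mul_ne_zero n2 n3)) ?_
  linear_combination -e4

end CausalBayesNet


/-! ### Hoeffding's lemma for a Bernoulli variable -/

open MeasureTheory in
-- This is the bounded-variable lemma for the identity under the law with mass m at 1 and 1 − m at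
-- 0. An interval of length 1 has variance proxy 1/4, whence t²/8.
theorem bernoulli_mgf_le {m : ℝ} (h0 : 0 ≤ m) (h1 : m ≤ 1) (t : ℝ) :
    m * Real.exp (t * (1 - m)) + (1 - m) * Real.exp (t * (0 - m)) ≤ Real.exp (t ^ 2 / 8) := by
  let μ : Measure ℝ := ENNReal.ofReal m • Measure.dirac 1 + ENNReal.ofReal (1 - m) • Measure.dirac 0
  have hμ : IsProbabilityMeasure μ := ⟨by
    simp only [μ, Measure.add_apply, Measure.smul_apply, measure_univ, smul_eq_mul, mul_one]
    rw [← ENNReal.ofReal_add h0 (by linarith)]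
    simp⟩
  have hint : ∀ f : ℝ → ℝ, Continuous f → ∫ x, f x ∂μ = m * f 1 + (1 - m) * f 0 := by
    intro f hf
    have i1 : ∀ a : ℝ, Integrable f (Measure.dirac a) := fun a =>
      integrable_dirac (by simp)
    rw [integral_add_measure ((i1 1).smul_measure (by simp)) ((i1 0).smul_measure (by simp)),
      integral_smul_measure, integral_smul_measure, integral_dirac, integral_dirac,
      ENNReal.toReal_ofReal h0, ENNReal.toReal_ofReal (by linarith)]
    rfl
  have hmean : ∫ x, x ∂μ = m := by
    rw [hint (fun x => x) (by fun_prop)]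
    ring
  have hbd : ∀ᵐ x ∂μ, x ∈ Set.Icc (0 : ℝ) 1 := by
    refine ae_add_measure_iff.2 ⟨?_, ?_⟩
    · refine Measure.ae_smul_measure ?_ _
      exact (ae_dirac_iff (p := (· ∈ Set.Icc (0 : ℝ) 1)) measurableSet_Icc).2 (by norm_num)
    · refine Measure.ae_smul_measure ?_ _
      exact (ae_dirac_iff (p := (· ∈ Set.Icc (0 : ℝ) 1)) measurableSet_Icc).2 (by norm_num)
  have h := (ProbabilityTheory.hasSubgaussianMGF_of_mem_Icc (μ := μ) (X := fun x => x)
    (by fun_prop) hbd).mgf_le t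
  rw [ProbabilityTheory.mgf, hint (fun ω => Real.exp (t * (ω - ∫ x, x ∂μ))) (by fun_prop),
    hmean] at h
  refine h.trans (le_of_eq ?_)
  congr 1
  simp
  ring

namespace NBModel

section

variable {V : Type} [Fintype V] [DecidableEq V] {M : ℕ} (S : NBModel V M)

/-! ### The distributions of the arms -/

theorem law_nonneg (a : Arm M) (ω : V → ℝ) : 0 ≤ S.law a ω := by
  rcases a with _ | ⟨i, x⟩ <;> exact S.doLaw_nonneg _ _ _

theorem cast_mem_range (i : Fin M) (x : Fin 2) : (x : ℝ) ∈ S.range (S.X i) := by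
  rw [S.range_X]
  fin_cases x <;> simp

theorem sum_law (a : Arm M) : ∑ ω ∈ S.worlds, S.law a ω = 1 := by
  rcases a with _ | ⟨i, x⟩
  · exact S.sum_doLaw_empty _
  · exact S.sum_doLaw_singleton _ _ (S.cast_mem_range i x)

theorem reward_mem {ω : V → ℝ} (h : ω ∈ S.worlds) : ω S.Y = 0 ∨ ω S.Y = 1 := by
  have := S.range_Y ((S.mem_worlds.1 h) S.Y)
  simpa using this

theorem reward_nonneg {ω : V → ℝ} (h : ω ∈ S.worlds) : 0 ≤ ω S.Y := by
  rcases S.reward_mem h with h | h <;> rw [h]; exact zero_le_one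

theorem reward_le_one {ω : V → ℝ} (h : ω ∈ S.worlds) : ω S.Y ≤ 1 := by
  rcases S.reward_mem h with h | h <;> rw [h]; exact zero_le_one

theorem mu_nonneg (a : Arm M) : 0 ≤ S.mu a :=
  Finset.sum_nonneg fun _ h => mul_nonneg (S.law_nonneg _ _) (S.reward_nonneg h)

theorem mu_le_one (a : Arm M) : S.mu a ≤ 1 := by
  rw [← S.sum_law a]
  exact Finset.sum_le_sum fun ω h => mul_le_of_le_one_right (S.law_nonneg _ _) (S.reward_le_one h)

theorem p_pos (i : Fin M) (x : Fin 2) : 0 < S.p i x := S.observable i x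

theorem p_eq (i : Fin M) (x : Fin 2) :
    S.p i x = ∑ ω ∈ S.worlds, S.law obsArm ω * (if ω (S.X i) = (x : ℝ) then 1 else 0) := by
  simp [p, Finset.sum_filter]

theorem p_le_one (i : Fin M) (x : Fin 2) : S.p i x ≤ 1 := by
  rw [p_eq]
  refine (Finset.sum_le_sum fun ω _ => mul_le_of_le_one_right (S.law_nonneg _ _) ?_).trans
    (S.sum_law obsArm).le
  split_ifs <;> norm_num

/-- The back-door criterion in the form used by the bandit: it is what justifies counting
observational rounds in E^{i,x}. -/
theorem sum_law_obs_ite_reward (i : Fin M) (x : Fin 2) :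
    ∑ ω ∈ S.worlds, S.law obsArm ω * (if ω (S.X i) = (x : ℝ) then ω S.Y else 0) =
      S.p i x * S.mu (intArm i x) := by
  have h := S.sum_doLaw_empty_eq_mul (S.X_ne_Y i) (S.no_backdoor i) (S.cast_mem_range i x)
  rw [Finset.sum_filter] at h
  simp only [mul_ite, mul_zero]
  refine (Eq.trans (Finset.sum_congr rfl fun ω _ => ?_) h).trans ?_
  · rfl
  · rw [Finset.sum_filter]
    simp only [p, mu, law, Finset.sum_filter]

/-! ### Expectations -/

variable {π : Policy V M}

/-- The histories at which a run of at most `n` rounds can end. -/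
def Final (S : NBModel V M) (π : Policy V M) (n : ℕ) (h : History V M) : Prop :=
  S.Reachable π h ∧ (π h = none ∨ h.length = n)

variable {S}

/-- Comparison is needed only at histories where the run can end, so pathwise bounds may use
reachability and the stopping condition. `N` stays fixed while elapsed and remaining rounds trade
off. -/
theorem expect_mono_aux {N : ℕ} {f g : History V M → ℝ} (hfg : ∀ h, S.Final π N h → f h ≤ g h) :
    ∀ (n : ℕ) (h : History V M), S.Reachable π h → h.length + n = N →
      S.expect π f n h ≤ S.expect π g n h
  | 0, h, hr, hn => hfg h ⟨hr, Or.inr hn⟩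
  | n + 1, h, hr, hn => by
    unfold expect
    rcases ha : π h with _ | a
    · exact hfg h ⟨hr, Or.inl ha⟩
    · exact Finset.sum_le_sum fun ω hω => mul_le_mul_of_nonneg_left
        (expect_mono_aux hfg n _ (hr.cons ha hω) (by simp; omega)) (S.law_nonneg _ _)

theorem expect_mono {n : ℕ} {f g : History V M → ℝ} (hfg : ∀ h, S.Final π n h → f h ≤ g h) :
    S.expect π f n [] ≤ S.expect π g n [] :=
  expect_mono_aux hfg n [] .nil (by simp)

theorem expect_add (f g : History V M → ℝ) : ∀ (n : ℕ) (h : History V M),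
    S.expect π (fun h => f h + g h) n h = S.expect π f n h + S.expect π g n h
  | 0, h => rfl
  | n + 1, h => by
    unfold expect
    rcases π h with _ | a
    · rfl
    · simp only [expect_add f g n, mul_add, Finset.sum_add_distrib]

theorem expect_mul_left (c : ℝ) (f : History V M → ℝ) : ∀ (n : ℕ) (h : History V M),
    S.expect π (fun h => c * f h) n h = c * S.expect π f n h
  | 0, h => rfl
  | n + 1, h => by
    unfold expect
    rcases π h with _ | a
    · rfl
    · simp only [expect_mul_left c f n, Finset.mul_sum]
      exact Finset.sum_congr rfl fun ω _ => by ring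

theorem expect_const (c : ℝ) : ∀ (n : ℕ) (h : History V M), S.expect π (fun _ => c) n h = c
  | 0, h => rfl
  | n + 1, h => by
    unfold expect
    rcases π h with _ | a
    · rfl
    · simp only [expect_const c n, ← Finset.sum_mul, S.sum_law, one_mul]

theorem expect_sum {ι : Type*} (s : Finset ι) (f : ι → History V M → ℝ) (n : ℕ)
    (h : History V M) :
    S.expect π (fun h => ∑ i ∈ s, f i h) n h = ∑ i ∈ s, S.expect π (f i) n h := by
  classical
  induction s using Finset.induction_on with
  | empty => simpa using expect_const (S := S) (π := π) 0 n h
  | insert i s hi ih => simp only [Finset.sum_insert hi, expect_add, ih]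

/-- The expectation of a supermartingale does not exceed its initial value. -/
theorem expect_le_of_step {f : History V M → ℝ}
    (hf : ∀ h a, ∑ ω ∈ S.worlds, S.law a ω * f ((a, ω) :: h) ≤ f h) :
    ∀ (n : ℕ) (h : History V M), S.expect π f n h ≤ f h
  | 0, h => le_rfl
  | n + 1, h => by
    unfold expect
    rcases π h with _ | a
    · exact le_rfl
    · exact (Finset.sum_le_sum fun ω _ => mul_le_mul_of_nonneg_left
        (expect_le_of_step hf n _) (S.law_nonneg _ _)).trans (hf h a)

theorem expect_eq_of_step {f : History V M → ℝ}
    (hf : ∀ h a, ∑ ω ∈ S.worlds, S.law a ω * f ((a, ω) :: h) = f h) :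
    ∀ (n : ℕ) (h : History V M), S.expect π f n h = f h
  | 0, h => rfl
  | n + 1, h => by
    unfold expect
    rcases π h with _ | a
    · rfl
    · simp only [expect_eq_of_step hf n, hf]

/-! ### Concentration -/

open Classical in
/-- The sum of the centred values of the sampled rounds. -/
def sampleSum (I : Arm M × (V → ℝ) → Prop) (y : Arm M × (V → ℝ) → ℝ) (m : ℝ)
    (h : History V M) : ℝ := ((h.filter fun e => I e).map fun e => y e - m).sum

open Classical in
/-- At some time, exactly `n` samples have been seen and their mean is off by at least `c`. -/
def Deviates (I : Arm M × (V → ℝ) → Prop) (y : Arm M × (V → ℝ) → ℝ) (m : ℝ) (n : ℕ) (c : ℝ)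
    (h : History V M) : Prop :=
  ∃ h', h' <:+ h ∧ (h'.filter fun e => I e).length = n ∧ n * c ≤ |sampleSum I y m h'|

open Classical in
/-- The indicator of a proposition. -/
def ind (p : Prop) : ℝ := if p then 1 else 0

theorem ind_nonneg (p : Prop) : 0 ≤ ind p := by unfold ind; split_ifs <;> norm_num

theorem ind_of {p : Prop} (h : p) : ind p = 1 := if_pos h

theorem ind_of_not {p : Prop} (h : ¬ p) : ind p = 0 := if_neg h

open Classical in
/-- The first `n` samples, latest first. -/
def firstSamples (I : Arm M × (V → ℝ) → Prop) (n : ℕ) (h : History V M) : History V M :=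
  (h.filter fun e => I e).drop ((h.filter fun e => I e).length - n)

/-- The exponential supermartingale, stopped after `n` samples. -/
def expMart (I : Arm M × (V → ℝ) → Prop) (y : Arm M × (V → ℝ) → ℝ) (m t : ℝ) (n : ℕ)
    (h : History V M) : ℝ :=
  ((firstSamples I n h).map fun e => Real.exp (t * (y e - m) - t ^ 2 / 8)).prod

variable {I : Arm M × (V → ℝ) → Prop} {y : Arm M × (V → ℝ) → ℝ} {m : ℝ}

open Classical in
theorem firstSamples_cons (n : ℕ) (e : Arm M × (V → ℝ)) (h : History V M) :
    firstSamples I n (e :: h) =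
      if I e ∧ (h.filter fun e => I e).length < n then e :: firstSamples I n h
      else firstSamples I n h := by
  unfold firstSamples
  by_cases hI : I e
  · simp only [List.filter_cons, hI, decide_true, if_true, true_and, List.length_cons]
    by_cases hn : (h.filter fun e => I e).length < n
    · rw [if_pos hn, Nat.sub_eq_zero_of_le hn, Nat.sub_eq_zero_of_le hn.le]
      simp
    · rw [if_neg hn, Nat.succ_sub (not_lt.1 hn)]
      simp
  · simp [hI]

theorem expMart_nonneg (t : ℝ) (n : ℕ) (h : History V M) : 0 ≤ expMart I y m t n h :=
  List.prod_nonneg fun x hx => by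
    obtain ⟨e, _, rfl⟩ := List.mem_map.1 hx
    exact (Real.exp_pos _).le

open Classical in
/-- The rounds satisfying `I` give samples of a Bernoulli variable with mean `m`, whatever arm
is pulled. -/
def SamplesOf (S : NBModel V M) (I : Arm M × (V → ℝ) → Prop) (y : Arm M × (V → ℝ) → ℝ)
    (m : ℝ) : Prop :=
  0 ≤ m ∧ m ≤ 1 ∧ (∀ a, ∀ ω ∈ S.worlds, y (a, ω) = 0 ∨ y (a, ω) = 1) ∧
    ∀ a, ∑ ω ∈ S.worlds, S.law a ω * (if I (a, ω) then y (a, ω) - m else 0) = 0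

open Classical in
-- On {0, 1} the function exp(t(y − m)) is affine in y. The centring condition therefore removes its
-- linear part whatever the probability of `I`, and `bernoulli_mgf_le` bounds the value left at y =
-- m.
theorem SamplesOf.sum_exp_le (hS : S.SamplesOf I y m) (t : ℝ) (a : Arm M) :
    ∑ ω ∈ S.worlds, S.law a ω *
      (if I (a, ω) then Real.exp (t * (y (a, ω) - m) - t ^ 2 / 8) else 1) ≤ 1 := by
  obtain ⟨h0, h1, hy, hm⟩ := hS
  set e1 := Real.exp (t * (1 - m)) with he1
  set e0 := Real.exp (t * (0 - m)) with he0
  have hb := bernoulli_mgf_le h0 h1 t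
  rw [← he1, ← he0] at hb
  set E := Real.exp (t ^ 2 / 8) with hE
  have hEpos : 0 < E := Real.exp_pos _
  have key : ∀ ω ∈ S.worlds, S.law a ω *
      (if I (a, ω) then Real.exp (t * (y (a, ω) - m) - t ^ 2 / 8) else 1) ≤
      S.law a ω + (e1 - e0) / E * (S.law a ω * (if I (a, ω) then y (a, ω) - m else 0)) := by
    intro ω hω
    have hl := S.law_nonneg a ω
    by_cases hI : I (a, ω)
    · simp only [if_pos hI]
      have hexp : Real.exp (t * (y (a, ω) - m) - t ^ 2 / 8) =
          ((m * e1 + (1 - m) * e0) + (y (a, ω) - m) * (e1 - e0)) / E := by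
        rw [Real.exp_sub, ← hE]
        congr 1
        rcases hy a ω hω with h | h <;> rw [h]
        · rw [← he0]; ring
        · rw [← he1]; ring
      have hone : (m * e1 + (1 - m) * e0) / E ≤ 1 := (div_le_one hEpos).2 hb
      rw [hexp, add_div]
      have := mul_le_mul_of_nonneg_left hone hl
      have e : S.law a ω * ((y (a, ω) - m) * (e1 - e0) / E) =
        (e1 - e0) / E * (S.law a ω * (y (a, ω) - m)) := by ring
      rw [mul_add, e]
      linarith
    · simp [if_neg hI]
  refine (Finset.sum_le_sum key).trans ?_
  rw [Finset.sum_add_distrib, ← Finset.mul_sum, hm, S.sum_law]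
  simp

open Classical in
-- Each of the first n samples contributes a factor of mean at most 1, and other rounds change
-- nothing. Freezing after n samples lets the final value record what happened at the time of the
-- n-th sample.
theorem SamplesOf.expect_expMart_le (hS : S.SamplesOf I y m) (t : ℝ) (n N : ℕ) :
    S.expect π (expMart I y m t n) N [] ≤ 1 := by
  refine (expect_le_of_step (fun h a => ?_) N []).trans (by simp [expMart, firstSamples])
  by_cases hn : (h.filter fun e => I e).length < n
  · have : ∀ ω ∈ S.worlds, S.law a ω * expMart I y m t n ((a, ω) :: h) =
        (S.law a ω * (if I (a, ω) then Real.exp (t * (y (a, ω) - m) - t ^ 2 / 8) else 1)) *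
          expMart I y m t n h := by
      intro ω _
      unfold expMart
      rw [firstSamples_cons]
      by_cases hI : I (a, ω)
      · rw [if_pos ⟨hI, hn⟩, if_pos hI, List.map_cons, List.prod_cons, mul_assoc]
      · rw [if_neg (fun h => hI h.1), if_neg hI, mul_one]
    rw [Finset.sum_congr rfl this, ← Finset.sum_mul]
    exact mul_le_of_le_one_left (expMart_nonneg _ _ _) (hS.sum_exp_le t a)
  · have : ∀ ω ∈ S.worlds, S.law a ω * expMart I y m t n ((a, ω) :: h) =
        S.law a ω * expMart I y m t n h := by
      intro ω _
      unfold expMart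
      rw [firstSamples_cons, if_neg (fun h => hn h.2)]
    rw [Finset.sum_congr rfl this, ← Finset.sum_mul, S.sum_law, one_mul]

theorem prod_map_exp (t : ℝ) (l : History V M) :
    (l.map fun e => Real.exp (t * (y e - m) - t ^ 2 / 8)).prod =
      Real.exp (t * (l.map fun e => y e - m).sum - l.length * (t ^ 2 / 8)) := by
  induction l with
  | nil => simp
  | cons e l ih =>
    rw [List.map_cons, List.prod_cons, ih, ← Real.exp_add, List.map_cons, List.sum_cons,
      List.length_cons]
    congr 1
    push_cast
    ring

open Classical in
-- The choice t = 4c maximizes tc − t²/8, with value 2c²; the two signs of t serve the two signs of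
-- the deviation.
theorem Deviates.expMart_ge {n : ℕ} {c : ℝ} (hc : 0 ≤ c) {h : History V M}
    (hd : Deviates I y m n c h) :
    Real.exp (2 * n * c ^ 2) ≤ expMart I y m (4 * c) n h + expMart I y m (-(4 * c)) n h := by
  obtain ⟨h', hsuf, hlen, hdev⟩ := hd
  -- Histories grow at the head, so the n samples in h' form a suffix of those in h: they are its
  -- first n samples.
  have hfs : firstSamples I n h = h'.filter fun e => I e := by
    have h1 : (h'.filter fun e => I e) <:+ h.filter fun e => I e := hsuf.filter _
    rw [List.suffix_iff_eq_drop] at h1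
    unfold firstSamples
    rw [← hlen]
    exact h1.symm
  have hval : ∀ t, expMart I y m t n h = Real.exp (t * sampleSum I y m h' - n * (t ^ 2 / 8)) := by
    intro t
    unfold expMart
    rw [hfs, prod_map_exp, hlen]
    rfl
  rcases le_abs.1 hdev with hpos | hneg
  · refine le_add_of_le_of_nonneg ?_ (expMart_nonneg _ _ _)
    rw [hval, Real.exp_le_exp]
    nlinarith [mul_le_mul_of_nonneg_left hpos hc]
  · refine le_add_of_nonneg_of_le (expMart_nonneg _ _ _) ?_
    rw [hval, Real.exp_le_exp]
    nlinarith [mul_le_mul_of_nonneg_left hneg hc]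

/-- Hoeffding's inequality for adaptively collected samples. -/
theorem SamplesOf.expect_ind_deviates_le (hS : S.SamplesOf I y m) (n N : ℕ) {c : ℝ}
    (hc : 0 ≤ c) :
    S.expect π (fun h => ind (Deviates I y m n c h)) N [] ≤ 2 * Real.exp (-(2 * n * c ^ 2)) := by
  have h1 : S.expect π (fun h => ind (Deviates I y m n c h)) N [] ≤
      S.expect π (fun h => Real.exp (-(2 * n * c ^ 2)) *
        (expMart I y m (4 * c) n h + expMart I y m (-(4 * c)) n h)) N [] := by
    refine expect_mono fun h _ => ?_
    by_cases hd : Deviates I y m n c h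
    · rw [ind_of hd, Real.exp_neg, inv_mul_eq_div, one_le_div (Real.exp_pos _)]
      exact hd.expMart_ge hc
    · rw [ind_of_not hd]
      exact mul_nonneg (Real.exp_pos _).le
        (add_nonneg (expMart_nonneg _ _ _) (expMart_nonneg _ _ _))
  rw [expect_mul_left, expect_add] at h1
  have h2 := hS.expect_expMart_le (π := π) (4 * c) n N
  have h3 := hS.expect_expMart_le (π := π) (-(4 * c)) n N
  have := mul_le_mul_of_nonneg_left (add_le_add h2 h3) (Real.exp_pos (-(2 * n * c ^ 2))).le
  linarith

open Classical in
/-- The rounds that give a sample for an arm have the mean reward of this arm. -/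
theorem samplesOf_isSample (a : Arm M) : S.SamplesOf (S.IsSample a) (fun e => e.2 S.Y) (S.mu a) := by
  refine ⟨S.mu_nonneg a, S.mu_le_one a, fun _ ω hω => S.reward_mem hω, fun b => ?_⟩
  have own : ∑ ω ∈ S.worlds, S.law a ω * (ω S.Y - S.mu a) = 0 := by
    simp only [mul_sub, Finset.sum_sub_distrib, ← Finset.sum_mul, S.sum_law, one_mul]
    exact sub_self _
  rcases a with _ | ⟨i, x⟩
  · by_cases hb : b = obsArm
    · subst hb
      simpa [IsSample] using own
    · simp [IsSample, hb]
  · by_cases hb : b = intArm i x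
    · subst hb
      simpa [IsSample] using own
    · by_cases hb' : b = obsArm
      · subst hb'
        -- In an observational round the sampled worlds have mass p_{i,x} and carry reward
        -- p_{i,x}·μ_{i,x}, so the centred sum vanishes.
        have h := S.sum_law_obs_ite_reward i x
        have h2 := S.p_eq i x
        have : ∀ ω ∈ S.worlds, S.law obsArm ω *
            (if S.IsSample (some (i, x)) (obsArm, ω) then ω S.Y - S.mu (some (i, x)) else 0) =
            S.law obsArm ω * (if ω (S.X i) = (x : ℝ) then ω S.Y else 0) -
            (S.law obsArm ω * (if ω (S.X i) = (x : ℝ) then 1 else 0)) * S.mu (intArm i x) := by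
          intro ω _
          by_cases hx : ω (S.X i) = (x : ℝ) <;> simp [IsSample, hx]
          ring
        rw [Finset.sum_congr rfl this, Finset.sum_sub_distrib, h, ← Finset.sum_mul, ← h2, sub_self]
      · simp [IsSample, hb, hb']

open Classical in
/-- The observational rounds sample the event `X i = x`. -/
theorem samplesOf_obs (i : Fin M) (x : Fin 2) :
    S.SamplesOf (S.IsSample obsArm) (fun e => if e.2 (S.X i) = (x : ℝ) then 1 else 0)
      (S.p i x) := by
  refine ⟨(S.p_pos i x).le, S.p_le_one i x, fun _ ω _ => ?_, fun b => ?_⟩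
  · by_cases h : ω (S.X i) = (x : ℝ) <;> simp [h]
  · by_cases hb : b = obsArm
    · subst hb
      simp only [IsSample, if_true]
      simp only [mul_sub, Finset.sum_sub_distrib, ← Finset.sum_mul, S.sum_law, one_mul]
      rw [← p_eq, sub_self]
    · simp [IsSample, hb]

end

section

/-! ### Counting rounds -/

section Counting

variable {V : Type} {M : ℕ}

open Classical in
/-- The number of rounds `e`, with preceding history `h'`, for which `P e h'` holds. -/
def occ (P : Arm M × (V → ℝ) → History V M → Prop) : History V M → ℕ
  | [] => 0
  | e :: h => occ P h + if P e h then 1 else 0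

variable {P Q R : Arm M × (V → ℝ) → History V M → Prop} {h : History V M}

theorem occ_mono_suffix {h' : History V M} (hs : h' <:+ h) : occ P h' ≤ occ P h := by
  induction h with
  | nil => rw [List.suffix_nil.1 hs]
  | cons e h ih =>
    rcases List.suffix_cons_iff.1 hs with rfl | hs
    · exact le_rfl
    · exact (ih hs).trans (Nat.le_add_right _ _)

theorem occ_le_add (H : ∀ e h', e :: h' <:+ h → P e h' → Q e h' ∨ R e h') :
    occ P h ≤ occ Q h + occ R h := by
  induction h with
  | nil => simp [occ]
  | cons e h ih =>
    have ih := ih fun e' h' hs => H e' h' (hs.trans (List.suffix_cons _ _))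
    have := H e h List.suffix_rfl
    unfold occ
    by_cases hP : P e h
    · rcases this hP with hQ | hR
      · simp only [if_pos hP, if_pos hQ]; omega
      · simp only [if_pos hP, if_pos hR]; omega
    · simp only [if_neg hP]; omega

theorem occ_le_of_imp (H : ∀ e h', e :: h' <:+ h → P e h' → Q e h') : occ P h ≤ occ Q h := by
  have := occ_le_add (R := fun _ _ => False) fun e h' hs hP => Or.inl (H e h' hs hP)
  have h0 : ∀ h : History V M, occ (fun _ _ => False) h = 0 := fun h => by
    induction h with
    | nil => rfl
    | cons e h ih => simp [occ, ih]
  rwa [h0, add_zero] at this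

theorem occ_le_sum_arm : occ P h ≤ ∑ a, occ (fun e h' => e.1 = a ∧ P e h') h := by
  induction h with
  | nil => simp [occ]
  | cons e h ih =>
    simp only [occ, Finset.sum_add_distrib]
    refine add_le_add ih ?_
    by_cases hP : P e h <;> simp [hP]

theorem occ_true : occ (fun _ _ => True) h = h.length := by
  induction h with
  | nil => rfl
  | cons e h ih => simp [occ, ih]

theorem occ_length_lt (s : ℕ) : occ (fun _ h' => h'.length < s) h ≤ s := by
  suffices H : occ (fun _ h' => h'.length < s) h ≤ min s h.length from H.trans (min_le_left _ _)
  induction h with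
  | nil => simp [occ]
  | cons e h ih =>
    unfold occ
    split_ifs with hs <;> simp only [List.length_cons] <;> omega

/-- If `P` only happens while it has happened at most `m` times, it happens at most `m + 1`
times. -/
theorem occ_le_add_one {m : ℝ} (hm : 0 ≤ m)
    (H : ∀ e h', e :: h' <:+ h → P e h' → (occ P h' : ℝ) ≤ m) : (occ P h : ℝ) ≤ m + 1 := by
  induction h with
  | nil => simp [occ]; linarith
  | cons e h ih =>
    have ih := ih fun e' h' hs => H e' h' (hs.trans (List.suffix_cons _ _))
    unfold occ
    by_cases hP : P e h
    · have := H e h List.suffix_rfl hP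
      rw [if_pos hP]
      push_cast
      linarith
    · simpa [if_neg hP] using ih

/-- The number of pulls of an arm. -/
def pulls (a : Arm M) : History V M → ℕ := occ fun e _ => e.1 = a

theorem sum_pulls_mul_cons (w : Arm M → ℝ) (e : Arm M × (V → ℝ)) (h : History V M) :
    ∑ a, (pulls a (e :: h) : ℝ) * w a = ∑ a, (pulls a h : ℝ) * w a + w e.1 := by
  simp [pulls, occ, add_mul, Finset.sum_add_distrib]

theorem sum_map_eq_sum_pulls (w : Arm M → ℝ) (h : History V M) :
    (h.map fun e => w e.1).sum = ∑ a, (pulls a h : ℝ) * w a := by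
  induction h with
  | nil => simp [pulls, occ]
  | cons e h ih => rw [sum_pulls_mul_cons, List.map_cons, List.sum_cons, ih, add_comm]

theorem pulls_pos {a : Arm M} (ha : ∃ e ∈ h, e.1 = a) : 0 < pulls a h := by
  induction h with
  | nil => simp at ha
  | cons e h ih =>
    unfold pulls occ
    by_cases he : e.1 = a
    · simp [he]
    · obtain ⟨e', he', hea⟩ := ha
      rcases List.mem_cons.1 he' with rfl | he'
      · exact absurd hea he
      · exact Nat.add_pos_left (ih ⟨e', he', hea⟩) _

theorem one_le_armCost {γ : ℝ} (hγ : 1 ≤ γ) (a : Arm M) : 1 ≤ armCost γ a := by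
  unfold armCost
  split_ifs <;> linarith

theorem armCost_le {γ : ℝ} (hγ : 1 ≤ γ) (a : Arm M) : armCost γ a ≤ γ := by
  unfold armCost
  split_ifs <;> linarith

theorem armCost_pos {γ : ℝ} (hγ : 1 ≤ γ) (a : Arm M) : 0 < armCost γ a :=
  zero_lt_one.trans_le (one_le_armCost hγ a)

theorem cost_cons (γ : ℝ) (e : Arm M × (V → ℝ)) (h : History V M) :
    cost γ (e :: h) = cost γ h + armCost γ e.1 := by
  simp [cost, add_comm]

theorem length_le_cost {γ : ℝ} (hγ : 1 ≤ γ) (h : History V M) : (h.length : ℝ) ≤ cost γ h := by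
  induction h with
  | nil => simp [cost]
  | cons e h ih =>
    rw [cost_cons, List.length_cons]
    push_cast
    linarith [one_le_armCost hγ e.1]

/-- Rounds that are played while less than `c` of the budget remains. -/
theorem occ_low_budget_le {γ B c : ℝ} (hγ : 1 ≤ γ) (hc : 0 ≤ c) (hB : cost γ h ≤ B) :
    (occ (fun _ h' => B - cost γ h' < c) h : ℝ) ≤ c := by
  -- This form is inductive: each counted round costs at least 1, and more than B − c was already
  -- spent before the first of them.
  suffices H : (occ (fun _ h' => B - cost γ h' < c) h : ℝ) ≤ max 0 (c + cost γ h - B) from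
    H.trans (max_le hc (by linarith))
  clear hB
  induction h with
  | nil => simp [occ]
  | cons e h ih =>
    have h1 := one_le_armCost hγ e.1
    unfold occ
    rw [cost_cons]
    by_cases hP : B - cost γ h < c
    · rw [if_pos hP]
      rw [max_eq_right (by linarith)] at ih
      push_cast
      exact le_max_of_le_right (by linarith)
    · rw [if_neg hP]
      refine (by simpa using ih : _ ≤ _).trans (max_le_max_left _ (by linarith))

end Counting

variable {V : Type} [Fintype V] [DecidableEq V] {M : ℕ} {S : NBModel V M}

theorem effPulls_eq_occ (a : Arm M) (h : History V M) :
    S.effPulls a h = occ (fun e _ => S.IsSample a e) h := by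
  induction h with
  | nil => simp [effPulls, occ]
  | cons e h ih =>
    unfold effPulls at ih ⊢
    unfold occ
    rw [← ih]
    by_cases he : S.IsSample a e <;> simp [he]

theorem effPulls_obs (h : History V M) : S.effPulls obsArm h = pulls obsArm h :=
  effPulls_eq_occ _ _

/-- The number of observational rounds in which `X i = x` was seen. -/
def obsCount (S : NBModel V M) (i : Fin M) (x : Fin 2) : History V M → ℕ :=
  occ fun e _ => e.1 = obsArm ∧ e.2 (S.X i) = (x : ℝ)

theorem effPulls_int (i : Fin M) (x : Fin 2) (h : History V M) :
    S.effPulls (intArm i x) h = pulls (intArm i x) h + S.obsCount i x h := by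
  rw [effPulls_eq_occ]
  induction h with
  | nil => simp [occ, pulls, obsCount]
  | cons e h ih =>
    simp only [pulls, obsCount, occ] at ih ⊢
    rw [ih]
    rcases e with ⟨_ | ⟨j, z⟩, ω⟩
    · simp [IsSample, add_assoc]
    · simp [IsSample]
      ring

theorem pulls_le_effPulls (a : Arm M) (h : History V M) : pulls a h ≤ S.effPulls a h := by
  rcases a with _ | ⟨i, x⟩
  · exact (effPulls_obs h).ge
  · rw [effPulls_int]
    exact Nat.le_add_right _ _

theorem effPulls_mono {h h' : History V M} (hs : h' <:+ h) (a : Arm M) :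
    S.effPulls a h' ≤ S.effPulls a h := by
  simp only [effPulls_eq_occ]
  exact occ_mono_suffix hs

theorem effPulls_le_length (a : Arm M) (h : History V M) : S.effPulls a h ≤ h.length :=
  List.length_filter_le _ _

/-! ### Reachable histories -/

variable {π : Policy V M} {h : History V M}

theorem Reachable.of_cons {e : Arm M × (V → ℝ)} (hr : S.Reachable π (e :: h)) :
    S.Reachable π h ∧ π h = some e.1 ∧ e.2 ∈ S.worlds := by
  cases hr with
  | cons hh ha hω => exact ⟨hh, ha, hω⟩

theorem Reachable.suffix {h' : History V M} (hr : S.Reachable π h) (hs : h' <:+ h) :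
    S.Reachable π h' := by
  induction h with
  | nil => rwa [List.suffix_nil.1 hs]
  | cons e h ih =>
    rcases List.suffix_cons_iff.1 hs with rfl | hs
    · exact hr
    · exact ih hr.of_cons.1 hs

theorem Reachable.mem_worlds (hr : S.Reachable π h) {e : Arm M × (V → ℝ)} (he : e ∈ h) :
    e.2 ∈ S.worlds := by
  induction h with
  | nil => simp at he
  | cons e' h ih =>
    rcases List.mem_cons.1 he with rfl | he
    · exact hr.of_cons.2.2
    · exact ih hr.of_cons.1 he

theorem Reachable.muHat_mem (hr : S.Reachable π h) (a : Arm M) :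
    0 ≤ S.muHat a h ∧ S.muHat a h ≤ 1 := by
  unfold muHat
  constructor
  · refine div_nonneg (List.sum_nonneg fun x hx => ?_) (Nat.cast_nonneg _)
    obtain ⟨e, he, rfl⟩ := List.mem_map.1 hx
    exact S.reward_nonneg (hr.mem_worlds (List.mem_of_mem_filter he))
  · refine div_le_one_of_le₀ ?_ (Nat.cast_nonneg _)
    refine (List.sum_le_card_nsmul _ (1 : ℝ) fun x hx => ?_).trans ?_
    · obtain ⟨e, he, rfl⟩ := List.mem_map.1 hx
      exact S.reward_le_one (hr.mem_worlds (List.mem_of_mem_filter he))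
    · simp [effPulls]

theorem muHat_le_muHatMax (ix : Fin M × Fin 2) (h : History V M) :
    S.muHat (intArm ix.1 ix.2) h ≤ S.muHatMax h :=
  le_ciSup (f := fun ix : Fin M × Fin 2 => S.muHat (intArm ix.1 ix.2) h)
    (Set.finite_range _).bddAbove ix

theorem muHatMax_le {c : ℝ} (hc : 0 ≤ c) (H : ∀ i x, S.muHat (intArm i x) h ≤ c) :
    S.muHatMax h ≤ c :=
  Real.iSup_le (fun ix => H ix.1 ix.2) hc

/-! ### The exploration parameter -/

theorem beta_nonneg (γ : ℝ) : ∀ h : History V M, 0 ≤ S.beta γ h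
  | [] => zero_le_one
  | e :: h => by
    unfold beta
    split_ifs with hc
    · exact le_min (div_nonneg (by positivity) (by linarith [hc.2])) (Real.sqrt_nonneg _)
    · exact beta_nonneg γ h

theorem log_natCast_mono {m n : ℕ} (hmn : m ≤ n) : Real.log m ≤ Real.log n := by
  rcases Nat.eq_zero_or_pos m with rfl | hm
  · simpa using Real.log_natCast_nonneg n
  · exact Real.log_le_log (by exact_mod_cast hm) (by exact_mod_cast hmn)

/-- The cap √(log t) in the update keeps forced observations at O(log² t) even when the estimates
are useless. -/
theorem beta_sq_le (γ : ℝ) : ∀ h : History V M, S.beta γ h ^ 2 ≤ 1 + Real.log h.length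
  | [] => by simp [beta]
  | e :: h => by
    unfold beta
    split_ifs with hc
    · have h0 : 0 ≤ Real.log (e :: h).length := Real.log_natCast_nonneg _
      have h1 : 0 ≤ 2 * √2 / (S.muHatMax (e :: h) / γ - S.muHat obsArm (e :: h)) :=
        div_nonneg (by positivity) (by linarith [hc.2])
      refine (pow_le_pow_left₀ (le_min h1 (Real.sqrt_nonneg _)) (min_le_right _ _) 2).trans ?_
      rw [Real.sq_sqrt h0]
      linarith
    · refine (beta_sq_le γ h).trans ?_
      gcongr 1 + ?_
      exact log_natCast_mono (by simp)

theorem one_le_log_of_four_le {n : ℕ} (hn : 4 ≤ n) : 1 ≤ Real.log n := by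
  rw [Real.le_log_iff_exp_le (by exact_mod_cast (by omega : 0 < n))]
  have h4 : (4 : ℝ) ≤ n := by exact_mod_cast hn
  linarith [Real.exp_one_lt_d9]

/-- Estimates lie in [0, 1] and γ ≥ 1, so an estimated gap is at most 1 and 2√2 divided by it
exceeds 1. Updates occur only from round 2M + 2 ≥ 4 on, where log t ≥ 1. This guarantees log t
observations before anything is known about the estimates. -/
theorem Reachable.one_le_beta {γ : ℝ} (hγ : 1 ≤ γ) (hM : 1 ≤ M) :
    ∀ {h : History V M}, S.Reachable π h → 1 ≤ S.beta γ h
  | [], _ => le_rfl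
  | e :: h, hr => by
    unfold beta
    split_ifs with hc
    · refine le_min ?_ (Real.one_le_sqrt.2 (one_le_log_of_four_le (by omega)))
      have h1 : S.muHatMax (e :: h) ≤ 1 :=
        muHatMax_le zero_le_one fun i x => (hr.muHat_mem _).2
      have h2 : S.muHatMax (e :: h) / γ ≤ 1 := by
        rw [div_le_one (by linarith)]
        linarith
      have h3 := (hr.muHat_mem obsArm).1
      rw [le_div_iff₀ (by linarith [hc.2])]
      have h4 : 1 ≤ √(2 : ℝ) := Real.one_le_sqrt.2 (by norm_num)
      nlinarith
    · exact Reachable.one_le_beta hγ hM hr.of_cons.1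

/-! ### The rules of the algorithm -/

variable {γ B : ℝ} {tie : History V M → Finset (Arm M) → Arm M}

open Classical in
/-- The arms that have not been pulled yet. -/
def unpulled (h : History V M) : Finset (Arm M) := Finset.univ.filter fun a => ∀ e ∈ h, e.1 ≠ a

theorem mem_unpulled {a : Arm M} : a ∈ unpulled h ↔ a ∉ h.map Prod.fst := by
  simp only [unpulled, Finset.mem_filter, Finset.mem_univ, true_and, List.mem_map, not_exists,
    not_and]

open Classical in
theorem crmNB_eq (h : History V M) : S.crmNB γ B tie h =
    if (unpulled h).Nonempty then some (tie h (unpulled h))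
    else if B - cost γ h < 1 then none
    else if (S.effPulls obsArm h : ℝ) < S.beta γ h ^ 2 * Real.log (h.length + 1) ∨
        B - cost γ h < γ then some obsArm
    else some (tie h (Finset.univ.filter fun a => ∀ a', S.ucb γ a' h ≤ S.ucb γ a h)) := by
  unfold crmNB unpulled
  congr!

/-- While some arm is missing, each pull so far chose an arm that was then missing. Counting arms,
the initial phase ends within 2M + 1 rounds. -/
theorem nodup_of_unpulled (htie : IsSelection tie) :
    ∀ {h : History V M}, S.Reachable (S.crmNB γ B tie) h → (unpulled h).Nonempty →
      (h.map Prod.fst).Nodup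
  | [], _, _ => by simp
  | e :: h, hr, hu => by
    obtain ⟨hr', ha, -⟩ := hr.of_cons
    have hu' : (unpulled h).Nonempty := hu.mono fun a ha => by
      rw [mem_unpulled] at ha ⊢
      exact fun h' => ha (List.mem_cons_of_mem _ h')
    rw [crmNB_eq, if_pos hu', Option.some_inj] at ha
    have hmem := htie h _ hu'
    rw [ha, mem_unpulled] at hmem
    rw [List.map_cons, List.nodup_cons]
    exact ⟨hmem, nodup_of_unpulled htie hr' hu'⟩

theorem card_arm : Fintype.card (Arm M) = 2 * M + 1 := by
  simp [Arm, mul_comm]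

theorem unpulled_eq_empty (htie : IsSelection tie) (hr : S.Reachable (S.crmNB γ B tie) h)
    (hlen : 2 * M + 1 ≤ h.length) : unpulled h = ∅ := by
  by_contra hne
  have hu := Finset.nonempty_iff_ne_empty.2 hne
  have hnd := nodup_of_unpulled htie hr hu
  have h1 := List.toFinset_card_of_nodup hnd
  have h2 := Finset.card_lt_univ_of_notMem (s := (h.map Prod.fst).toFinset) (x := hu.choose) (by
    rw [List.mem_toFinset]
    exact mem_unpulled.1 hu.choose_spec)
  rw [card_arm] at h2
  rw [List.length_map] at h1
  omega

theorem effPulls_pos (htie : IsSelection tie) (hr : S.Reachable (S.crmNB γ B tie) h)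
    (hlen : 2 * M + 1 ≤ h.length) (a : Arm M) : 0 < S.effPulls a h := by
  refine lt_of_lt_of_le (pulls_pos ?_) (pulls_le_effPulls a h)
  by_contra hne
  have : a ∈ unpulled h := mem_unpulled.2 fun hm => by
    obtain ⟨e, he, hea⟩ := List.mem_map.1 hm
    exact hne ⟨e, he, hea⟩
  rw [unpulled_eq_empty htie hr hlen] at this
  simp at this

/-- After the initial pulls, every pull is affordable and follows one of the three rules. -/
theorem step_cases (htie : IsSelection tie) {e : Arm M × (V → ℝ)}
    (hr : S.Reachable (S.crmNB γ B tie) (e :: h)) (hlen : 2 * M + 1 ≤ h.length) :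
    1 ≤ B - cost γ h ∧
    ((e.1 = obsArm ∧ (S.effPulls obsArm h : ℝ) < S.beta γ h ^ 2 * Real.log (h.length + 1)) ∨
      (e.1 = obsArm ∧ B - cost γ h < γ) ∨
      (S.beta γ h ^ 2 * Real.log (h.length + 1) ≤ S.effPulls obsArm h ∧ γ ≤ B - cost γ h ∧
        ∀ a', S.ucb γ a' h ≤ S.ucb γ e.1 h)) := by
  classical
  obtain ⟨hr', ha, -⟩ := hr.of_cons
  rw [crmNB_eq, if_neg (by simp [unpulled_eq_empty htie hr' hlen])] at ha
  split_ifs at ha with h1 h2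
  · refine ⟨not_lt.1 h1, ?_⟩
    rw [Option.some_inj] at ha
    rcases h2 with h2 | h2
    · exact Or.inl ⟨ha.symm, h2⟩
    · exact Or.inr (Or.inl ⟨ha.symm, h2⟩)
  · push Not at h2
    refine ⟨not_lt.1 h1, Or.inr (Or.inr ⟨h2.1, h2.2, ?_⟩)⟩
    rw [Option.some_inj] at ha
    have hne : (Finset.univ.filter fun a : Arm M =>
        ∀ a', S.ucb γ a' h ≤ S.ucb γ a h).Nonempty := by
      obtain ⟨a, ha⟩ := Finite.exists_max fun a : Arm M => S.ucb γ a h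
      exact ⟨a, by simpa using ha⟩
    have := htie h _ hne
    rw [ha] at this
    simpa using this

theorem sum_armCost (γ : ℝ) : ∑ a : Arm M, armCost γ a = 1 + 2 * M * γ := by
  rw [Fintype.sum_option]
  simp [armCost]
  exact Or.inl (by ring)

theorem cost_le_of_nodup (hγ : 1 ≤ γ) (hnd : (h.map Prod.fst).Nodup) :
    cost γ h ≤ 1 + 2 * M * γ := by
  rw [← sum_armCost (M := M) γ]
  have : cost γ h = ∑ a ∈ (h.map Prod.fst).toFinset, armCost γ a := by
    rw [List.sum_toFinset _ hnd]
    simp [cost, Function.comp_def]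
  rw [this]
  exact Finset.sum_le_sum_of_subset_of_nonneg (Finset.subset_univ _)
    fun a _ _ => (armCost_pos hγ a).le

theorem crmNB_withinBudget (hγ : 1 ≤ γ) (hB : 1 + 2 * M * γ ≤ B) (htie : IsSelection tie) :
    S.WithinBudget γ B (S.crmNB γ B tie) := by
  intro h hr
  cases hr with
  | nil =>
    have : (0 : ℝ) ≤ 2 * M * γ := by positivity
    simp only [cost, List.map_nil, List.sum_nil]
    linarith
  | @cons h a ω hr' ha hω =>
    by_cases hu : (unpulled h).Nonempty
    · refine (cost_le_of_nodup hγ ?_).trans hB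
      have hmem := htie h _ hu
      rw [crmNB_eq, if_pos hu, Option.some_inj] at ha
      rw [ha, mem_unpulled] at hmem
      rw [List.map_cons, List.nodup_cons]
      exact ⟨hmem, nodup_of_unpulled htie hr' hu⟩
    · rw [crmNB_eq, if_neg hu] at ha
      rw [cost_cons]
      split_ifs at ha with h1 h2
      · rw [Option.some_inj] at ha
        subst ha
        simp only [armCost, if_true]
        linarith
      · push Not at h2
        linarith [armCost_le hγ a, h2.2]

/-- A finished run has spent all but less than `1` of the budget. -/
theorem Final.lt_cost (hγ : 1 ≤ γ) (hf : S.Final (S.crmNB γ B tie) ⌊B⌋₊ h) : B - 1 < cost γ h := by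
  rcases hf.2 with hn | hl
  · rw [crmNB_eq] at hn
    split_ifs at hn with h1 h2
    linarith
  · have := length_le_cost hγ h
    rw [hl] at this
    linarith [Nat.lt_floor_add_one B]

/-! ### Regret -/

theorem mu_eq_v_mul (hγ : 1 ≤ γ) (a : Arm M) : S.mu a = S.v γ a * armCost γ a :=
  (div_mul_cancel₀ _ (armCost_pos hγ a).ne').symm

/-- Wald's identity: the collected reward minus the sum of the means of the pulled arms is a
martingale started at 0. -/
theorem gain_eq (B : ℝ) (π : Policy V M) :
    S.gain B π = S.expect π (fun h => ∑ a, (pulls a h : ℝ) * S.mu a) ⌊B⌋₊ [] := by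
  have h := expect_eq_of_step (S := S) (π := π)
    (f := fun h => S.totalReward h + -1 * ∑ a, (pulls a h : ℝ) * S.mu a) (fun h a => by
      simp only [sum_pulls_mul_cons, totalReward, List.map_cons, List.sum_cons]
      have : ∀ ω ∈ S.worlds, S.law a ω * (ω S.Y + (List.map (fun e => e.2 S.Y) h).sum +
          -1 * (∑ a, (pulls a h : ℝ) * S.mu a + S.mu a)) =
          S.law a ω * ω S.Y + S.law a ω * ((List.map (fun e => e.2 S.Y) h).sum +
          -1 * ∑ a, (pulls a h : ℝ) * S.mu a - S.mu a) := fun ω _ => by ring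
      rw [Finset.sum_congr rfl this, Finset.sum_add_distrib, ← Finset.sum_mul, S.sum_law]
      change S.mu a + _ = _
      ring) ⌊B⌋₊ []
  rw [expect_add, expect_mul_left] at h
  simp only [totalReward, pulls, occ, List.map_nil, List.sum_nil, Nat.cast_zero, zero_mul,
    Finset.sum_const_zero, mul_zero, add_zero] at h
  unfold gain
  simp only [pulls]
  change S.expect π S.totalReward ⌊B⌋₊ [] + _ = 0 at h
  linarith

theorem v_nonneg (hγ : 1 ≤ γ) (a : Arm M) : 0 ≤ S.v γ a :=
  div_nonneg (S.mu_nonneg a) (armCost_pos hγ a).le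

theorem v_le_one (hγ : 1 ≤ γ) (a : Arm M) : S.v γ a ≤ 1 :=
  div_le_one_of_le₀ ((S.mu_le_one a).trans (one_le_armCost hγ a)) (armCost_pos hγ a).le

theorem sum_pulls_mul_mu (hγ : 1 ≤ γ) (aStar : Arm M) (h : History V M) :
    ∑ a, (pulls a h : ℝ) * S.mu a = S.v γ aStar * cost γ h -
      ∑ a, (pulls a h : ℝ) * (armCost γ a * S.d γ aStar a) := by
  have hc : cost γ h = ∑ a, (pulls a h : ℝ) * armCost γ a := sum_map_eq_sum_pulls (armCost γ) h
  rw [hc, Finset.mul_sum, ← Finset.sum_sub_distrib]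
  refine Finset.sum_congr rfl fun a _ => ?_
  rw [mu_eq_v_mul hγ a, d]
  ring

theorem gain_le (hγ : 1 ≤ γ) {aStar : Arm M} (hopt : ∀ a, S.v γ a ≤ S.v γ aStar)
    (hπ : S.WithinBudget γ B π) : S.gain B π ≤ S.v γ aStar * B := by
  rw [gain_eq, ← expect_const (S := S) (π := π) (S.v γ aStar * B) ⌊B⌋₊ []]
  refine expect_mono fun h hf => ?_
  rw [sum_pulls_mul_mu hγ aStar]
  have h1 := mul_le_mul_of_nonneg_left (hπ h hf.1) (v_nonneg (S := S) hγ aStar)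
  have h2 : 0 ≤ ∑ a, (pulls a h : ℝ) * (armCost γ a * S.d γ aStar a) :=
    Finset.sum_nonneg fun a _ => mul_nonneg (Nat.cast_nonneg _)
      (mul_nonneg (armCost_pos hγ a).le (sub_nonneg.2 (hopt a)))
  linarith

/-- The regret is controlled by the expected numbers of pulls of the suboptimal arms. -/
theorem abs_regret_le (hγ : 1 ≤ γ) {aStar : Arm M} (hopt : ∀ a, S.v γ a ≤ S.v γ aStar)
    (hB : 1 + 2 * M * γ ≤ B) (htie : IsSelection tie) :
    |S.regret γ B (S.crmNB γ B tie)| ≤ 1 + ∑ a, armCost γ a * S.d γ aStar a *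
      S.expect (S.crmNB γ B tie) (fun h => (pulls a h : ℝ)) ⌊B⌋₊ [] := by
  have hw := crmNB_withinBudget (S := S) hγ hB htie
  have hbdd : BddAbove {g | ∃ π : Policy V M, S.WithinBudget γ B π ∧ g = S.gain B π} :=
    ⟨S.v γ aStar * B, by
      rintro g ⟨π, hπ, rfl⟩
      exact gain_le hγ hopt hπ⟩
  have hlow : S.gain B (S.crmNB γ B tie) ≤ S.optGain γ B := le_csSup hbdd ⟨_, hw, rfl⟩
  have hup : S.optGain γ B ≤ S.v γ aStar * B := csSup_le ⟨_, _, hw, rfl⟩ (by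
    rintro g ⟨π, hπ, rfl⟩
    exact gain_le hγ hopt hπ)
  have hgain : S.v γ aStar * (B - 1) + -1 * ∑ a, armCost γ a * S.d γ aStar a *
      S.expect (S.crmNB γ B tie) (fun h => (pulls a h : ℝ)) ⌊B⌋₊ [] ≤
      S.gain B (S.crmNB γ B tie) := by
    simp only [← expect_mul_left]
    rw [← expect_sum, ← expect_mul_left,
      ← expect_const (S := S) (π := S.crmNB γ B tie) (S.v γ aStar * (B - 1)) ⌊B⌋₊ [],
      ← expect_add, gain_eq]
    refine expect_mono fun h hf => ?_
    rw [sum_pulls_mul_mu hγ aStar]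
    have h1 := mul_le_mul_of_nonneg_left (hf.lt_cost hγ).le (v_nonneg (S := S) hγ aStar)
    have h2 : ∀ a : Arm M, armCost γ a * S.d γ aStar a * (pulls a h : ℝ) =
      (pulls a h : ℝ) * (armCost γ a * S.d γ aStar a) := fun a => mul_comm _ _
    simp only [h2]
    linarith
  have hv := v_le_one (S := S) hγ aStar
  unfold regret
  -- The algorithm is itself admissible, so its regret is nonnegative. The summand 1 pays for the
  -- unspent budget, less than one unit at rate v_{a*} ≤ 1.
  rw [abs_of_nonneg (by linarith)]
  nlinarith

end

section

variable {V : Type} [Fintype V] [DecidableEq V] {M : ℕ} {S : NBModel V M}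
  {π : Policy V M} {h : History V M} {γ B : ℝ} {tie : History V M → Finset (Arm M) → Arm M}

/-! ### Accurate estimates -/

open Classical in
theorem sampleSum_eq (I : Arm M × (V → ℝ) → Prop) (y : Arm M × (V → ℝ) → ℝ) (m : ℝ)
    (h : History V M) : sampleSum I y m h =
      ((h.filter fun e => I e).map y).sum - (h.filter fun e => I e).length * m := by
  unfold sampleSum
  induction h.filter fun e => I e with
  | nil => simp
  | cons e l ih =>
    simp only [List.map_cons, List.sum_cons, ih, List.length_cons]
    push_cast
    ring

/-- The reward of a round. -/
def reward (S : NBModel V M) (e : Arm M × (V → ℝ)) : ℝ := e.2 S.Y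

theorem sampleSum_isSample (a : Arm M) (hpos : 0 < S.effPulls a h) :
    sampleSum (S.IsSample a) S.reward (S.mu a) h =
      S.effPulls a h * (S.muHat a h - S.mu a) := by
  classical
  have : (S.effPulls a h : ℝ) ≠ 0 := by exact_mod_cast hpos.ne'
  rw [sampleSum_eq, muHat, mul_sub, mul_div_cancel₀ _ this]
  rfl

theorem deviates_of_lt {a : Arm M} {c : ℝ} {h' : History V M} (hs : h' <:+ h)
    (hpos : 0 < S.effPulls a h') (hc : c < |S.muHat a h' - S.mu a|) :
    Deviates (S.IsSample a) S.reward (S.mu a) (S.effPulls a h') c h := by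
  refine ⟨h', hs, rfl, ?_⟩
  rw [sampleSum_isSample a hpos, abs_mul, Nat.abs_cast]
  exact mul_le_mul_of_nonneg_left hc.le (Nat.cast_nonneg _)

open Classical in
/-- The indicator of `X i = x` in a round. -/
def seen (S : NBModel V M) (i : Fin M) (x : Fin 2) (e : Arm M × (V → ℝ)) : ℝ :=
  if e.2 (S.X i) = (x : ℝ) then 1 else 0

open Classical in
theorem sampleSum_seen (i : Fin M) (x : Fin 2) (h : History V M) :
    sampleSum (S.IsSample obsArm) (S.seen i x) (S.p i x) h =
      S.obsCount i x h - S.effPulls obsArm h * S.p i x := by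
  rw [sampleSum_eq]
  congr 1
  induction h with
  | nil => simp [obsCount, occ]
  | cons e h ih =>
    unfold obsCount at ih ⊢
    unfold occ
    by_cases he : e.1 = obsArm
    · by_cases hx : e.2 (S.X i) = (x : ℝ) <;>
        simp [IsSample, he, hx, seen, add_comm] at ih ⊢ <;> exact ih
    · simp [IsSample, he] at ih ⊢
      exact ih

theorem deviates_of_obsCount_lt {i : Fin M} {x : Fin 2} {c : ℝ} {h' : History V M}
    (hs : h' <:+ h) (hc : (S.obsCount i x h' : ℝ) < (S.p i x - c) * S.effPulls obsArm h') :
    Deviates (S.IsSample obsArm) (S.seen i x) (S.p i x) (S.effPulls obsArm h') c h := by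
  refine ⟨h', hs, rfl, ?_⟩
  rw [sampleSum_seen]
  refine le_trans ?_ (neg_le_abs _)
  linarith

/-- Half of the confidence radius of an arm. -/
def rad (S : NBModel V M) (a : Arm M) (h : History V M) : ℝ :=
  √(2 * Real.log h.length / S.effPulls a h)

/-- All estimates are correct up to half of the confidence radius. -/
def Accurate (S : NBModel V M) (h : History V M) : Prop :=
  ∀ a, |S.muHat a h - S.mu a| ≤ S.rad a h

theorem rad_nonneg (a : Arm M) (h : History V M) : 0 ≤ S.rad a h := Real.sqrt_nonneg _

theorem rad_sq (a : Arm M) (h : History V M) :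
    S.rad a h ^ 2 = 2 * Real.log h.length / S.effPulls a h :=
  Real.sq_sqrt (div_nonneg (mul_nonneg zero_le_two (Real.log_natCast_nonneg _)) (Nat.cast_nonneg _))

theorem ucb_eq (a : Arm M) (h : History V M) :
    S.ucb γ a h = (S.muHat a h + 2 * S.rad a h) / armCost γ a := by
  unfold ucb rad
  congr 2
  rw [show (8 : ℝ) * Real.log h.length / S.effPulls a h =
    2 ^ 2 * (2 * Real.log h.length / S.effPulls a h) by ring,
    Real.sqrt_mul (by norm_num), Real.sqrt_sq (by norm_num)]

/-- The index adds two half-radii to an estimate that is off by at most one. Up to the cost factor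
it thus lies between v + rad and v + 3 rad. The 3, squared against rad² = 2 log t / E, is the origin
of the constant 18. -/
theorem Accurate.ucb_compare (hγ : 1 ≤ γ) (hacc : S.Accurate h) {a b : Arm M}
    (hab : S.ucb γ b h ≤ S.ucb γ a h) :
    S.v γ b + S.rad b h / armCost γ b ≤ S.v γ a + 3 * (S.rad a h / armCost γ a) := by
  have h1 : (S.mu b + S.rad b h) / armCost γ b ≤ S.ucb γ b h := by
    rw [ucb_eq]
    refine div_le_div_of_nonneg_right ?_ (armCost_pos hγ b).le
    linarith [(abs_le.1 (hacc b)).1]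
  have h2 : S.ucb γ a h ≤ (S.mu a + 3 * S.rad a h) / armCost γ a := by
    rw [ucb_eq]
    refine div_le_div_of_nonneg_right ?_ (armCost_pos hγ a).le
    linarith [(abs_le.1 (hacc a)).2]
  have := (h1.trans hab).trans h2
  rw [add_div, add_div, mul_div_assoc] at this
  exact this

/-- An arm with the largest index has few samples if it is suboptimal. -/
theorem Accurate.effPulls_le (hγ : 1 ≤ γ) (hacc : S.Accurate h) {a b : Arm M}
    (hopt : S.v γ a ≤ S.v γ b) (hpos : 0 < S.effPulls a h)
    (hab : S.ucb γ b h ≤ S.ucb γ a h) :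
    (armCost γ a * S.d γ b a) ^ 2 * S.effPulls a h ≤ 18 * Real.log h.length := by
  have h1 := hacc.ucb_compare hγ hab
  have hc := armCost_pos hγ a
  have h2 : S.d γ b a ≤ 3 * (S.rad a h / armCost γ a) := by
    have := div_nonneg (rad_nonneg (S := S) b h) (armCost_pos hγ b).le
    unfold d
    linarith
  have h3 : armCost γ a * S.d γ b a ≤ 3 * S.rad a h := by
    calc armCost γ a * S.d γ b a ≤ armCost γ a * (3 * (S.rad a h / armCost γ a)) :=
        mul_le_mul_of_nonneg_left h2 hc.le
      _ = 3 * S.rad a h := by field_simp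
  have h4 := pow_le_pow_left₀ (mul_nonneg hc.le (sub_nonneg.2 hopt)) h3 2
  have hE : (0 : ℝ) < S.effPulls a h := by exact_mod_cast hpos
  calc (armCost γ a * S.d γ b a) ^ 2 * S.effPulls a h
      ≤ (3 * S.rad a h) ^ 2 * S.effPulls a h := mul_le_mul_of_nonneg_right h4 hE.le
    _ = 18 * Real.log h.length := by
      rw [mul_pow, rad_sq]
      field_simp
      ring

/-- An arm with the largest index has not many more samples than an optimal arm. -/
theorem Accurate.effPulls_le_mul (hγ : 1 ≤ γ) (hacc : S.Accurate h) {a b : Arm M}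
    (hopt : S.v γ a ≤ S.v γ b) (ha : 0 < S.effPulls a h) (hb : 0 < S.effPulls b h)
    (hlen : 2 ≤ h.length) (hab : S.ucb γ b h ≤ S.ucb γ a h) :
    (S.effPulls a h : ℝ) ≤ 9 * γ ^ 2 * S.effPulls b h := by
  have h1 := hacc.ucb_compare hγ hab
  have hra := rad_nonneg (S := S) a h
  have hrb := rad_nonneg (S := S) b h
  -- Since v_a ≤ v_b, the values drop out of the index comparison and only the radii remain; the
  -- costs lie between 1 and γ.
  have h2 : S.rad b h / γ ≤ 3 * S.rad a h := by
    have e1 : S.rad b h / γ ≤ S.rad b h / armCost γ b :=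
      div_le_div_of_nonneg_left hrb (armCost_pos hγ b) (armCost_le hγ b)
    have e2 : S.rad a h / armCost γ a ≤ S.rad a h := div_le_self hra (one_le_armCost hγ a)
    linarith
  have hγ0 : 0 < γ := by linarith
  have h3 := pow_le_pow_left₀ (by positivity) h2 2
  rw [div_pow, mul_pow, rad_sq, rad_sq, div_le_iff₀ (by positivity)] at h3
  have hA : (0 : ℝ) < S.effPulls a h := by exact_mod_cast ha
  have hB : (0 : ℝ) < S.effPulls b h := by exact_mod_cast hb
  have hL : 0 < Real.log h.length := Real.log_pos (by exact_mod_cast hlen)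
  rw [div_le_iff₀ hB, ← mul_le_mul_iff_left₀ hA] at h3
  have e : 3 ^ 2 * (2 * Real.log h.length / S.effPulls a h) * γ ^ 2 * S.effPulls b h *
      S.effPulls a h = 2 * Real.log h.length * (9 * γ ^ 2 * S.effPulls b h) := by
    field_simp
    ring
  rw [e] at h3
  exact le_of_mul_le_mul_left h3 (by linarith)

/-! ### The number of inaccurate rounds -/

/-- Bounds the indicator of an inaccurate estimate at some time between `s / 2` and `s`. -/
def badness (S : NBModel V M) (s : ℕ) (h : History V M) : ℝ :=
  ∑ j ∈ (Finset.range (s + 1)).filter (fun j => s ≤ 2 * j), ∑ a, ∑ n ∈ Finset.Icc 1 j,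
    ind (Deviates (S.IsSample a) S.reward (S.mu a) n √(2 * Real.log j / n) h)

theorem badness_nonneg (s : ℕ) (h : History V M) : 0 ≤ S.badness s h :=
  Finset.sum_nonneg fun _ _ => Finset.sum_nonneg fun _ _ => Finset.sum_nonneg fun _ _ =>
    ind_nonneg _

/-- One deviation alone already contributes 1 to the sum. The union over n is needed because the
sample count is random, and the window down to s/2 because linear growth uses accuracy throughout
it. -/
theorem accurate_of_badness_lt (htie : IsSelection tie)
    (hr : S.Reachable (S.crmNB γ B tie) h) {h' : History V M} (hs : h' <:+ h) {s : ℕ}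
    (hM : 2 * M + 1 ≤ h'.length) (h1 : s ≤ 2 * h'.length) (h2 : h'.length ≤ s)
    (hb : S.badness s h < 1) : S.Accurate h' := by
  intro a
  by_contra hlt
  rw [not_le] at hlt
  have hpos := effPulls_pos htie (hr.suffix hs) hM a
  have hdev := deviates_of_lt hs hpos hlt
  refine hb.not_ge ?_
  have e1 : (1 : ℝ) = ind (Deviates (S.IsSample a) S.reward (S.mu a) (S.effPulls a h')
      √(2 * Real.log h'.length / S.effPulls a h') h) := (ind_of hdev).symm
  rw [e1]
  refine le_trans ?_ (Finset.single_le_sum (f := fun j => ∑ a, ∑ n ∈ Finset.Icc 1 j,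
    ind (Deviates (S.IsSample a) S.reward (S.mu a) n √(2 * Real.log j / n) h))
    (fun _ _ => Finset.sum_nonneg fun _ _ => Finset.sum_nonneg fun _ _ => ind_nonneg _)
    (Finset.mem_filter.2 ⟨Finset.mem_range.2 (Nat.lt_succ_of_le h2), h1⟩))
  refine le_trans ?_ (Finset.single_le_sum (f := fun a => ∑ n ∈ Finset.Icc 1 h'.length,
    ind (Deviates (S.IsSample a) S.reward (S.mu a) n √(2 * Real.log h'.length / n) h))
    (fun _ _ => Finset.sum_nonneg fun _ _ => ind_nonneg _) (Finset.mem_univ a))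
  exact Finset.single_le_sum (f := fun n : ℕ =>
    ind (Deviates (S.IsSample a) S.reward (S.mu a) n √(2 * Real.log h'.length / n) h))
    (fun _ _ => ind_nonneg _) (Finset.mem_Icc.2 ⟨hpos, effPulls_le_length a h'⟩)

/-- Hoeffding gives 2/j⁴ for each arm and n. Summing over n ≤ j gives 2/j³ ≤ 16/s³, as j ≥ s/2.
There are 2M + 1 arms and at most s + 1 ≤ 2s times j. -/
theorem expect_badness_le (s N : ℕ) :
    S.expect π (S.badness s) N [] ≤ 32 * (2 * M + 1) * (1 / (s : ℝ) ^ 2) := by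
  unfold badness
  -- At s = 0 the sum over n is empty and 1/0² is 0.
  rcases Nat.eq_zero_or_pos s with rfl | hs
  · simp [expect_const]
  rw [expect_sum]
  have hs' : (0 : ℝ) < s := by exact_mod_cast hs
  have key : ∀ j ∈ (Finset.range (s + 1)).filter (fun j => s ≤ 2 * j),
      S.expect π (fun h => ∑ a, ∑ n ∈ Finset.Icc 1 j,
        ind (Deviates (S.IsSample a) S.reward (S.mu a) n √(2 * Real.log j / n) h)) N [] ≤
      16 * (2 * M + 1) / (s : ℝ) ^ 3 := by
    intro j hj
    rw [Finset.mem_filter, Finset.mem_range] at hj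
    have hj0 : 0 < j := by omega
    have hj' : (0 : ℝ) < j := by exact_mod_cast hj0
    have hsj : (s : ℝ) ≤ 2 * j := by exact_mod_cast hj.2
    rw [expect_sum]
    have inner : ∀ a : Arm M, S.expect π (fun h => ∑ n ∈ Finset.Icc 1 j,
        ind (Deviates (S.IsSample a) S.reward (S.mu a) n √(2 * Real.log j / n) h)) N [] ≤
        16 / (s : ℝ) ^ 3 := by
      intro a
      rw [expect_sum]
      have inner2 : ∀ n ∈ Finset.Icc 1 j, S.expect π (fun h =>
          ind (Deviates (S.IsSample a) S.reward (S.mu a) n √(2 * Real.log j / n) h)) N [] ≤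
          2 / (j : ℝ) ^ 4 := by
        intro n hn
        have hn' : (0 : ℝ) < n := by exact_mod_cast (Finset.mem_Icc.1 hn).1
        refine ((samplesOf_isSample a).expect_ind_deviates_le n N (Real.sqrt_nonneg _)).trans
          (le_of_eq ?_)
        rw [Real.sq_sqrt (div_nonneg (mul_nonneg zero_le_two (Real.log_natCast_nonneg _)) hn'.le)]
        have e : 2 * (n : ℝ) * (2 * Real.log j / n) = 4 * Real.log j := by
          field_simp
          ring
        rw [e, Real.exp_neg, div_eq_mul_inv]
        congr 2
        rw [show (4 : ℝ) * Real.log j = ((4 : ℕ) : ℝ) * Real.log j by norm_num, Real.exp_nat_mul,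
          Real.exp_log hj']
      refine (Finset.sum_le_sum inner2).trans ?_
      rw [Finset.sum_const, Nat.card_Icc, nsmul_eq_mul, Nat.add_sub_cancel]
      have e : (j : ℝ) * (2 / (j : ℝ) ^ 4) = 16 / (2 * j) ^ 3 := by
        field_simp
        ring
      rw [e]
      gcongr
    refine (Finset.sum_le_sum fun a _ => inner a).trans (le_of_eq ?_)
    rw [Finset.sum_const, Finset.card_univ, card_arm, nsmul_eq_mul]
    push_cast
    ring
  refine (Finset.sum_le_sum key).trans ?_
  rw [Finset.sum_const, nsmul_eq_mul]
  have hcard : (((Finset.range (s + 1)).filter (fun j => s ≤ 2 * j)).card : ℝ) ≤ 2 * s := by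
    have := Finset.card_filter_le (Finset.range (s + 1)) (fun j => s ≤ 2 * j)
    rw [Finset.card_range] at this
    exact_mod_cast (by omega : _ ≤ 2 * s)
  refine (mul_le_mul_of_nonneg_right hcard (by positivity)).trans (le_of_eq ?_)
  field_simp
  ring

theorem summable_badness_bound (M : ℕ) :
    Summable fun s : ℕ => 32 * (2 * (M : ℝ) + 1) * (1 / (s : ℝ) ^ 2) :=
  (Real.summable_one_div_nat_pow.2 (by norm_num)).mul_left _

/-- Rounds after `s₁` that are charged to an event of their time. -/
theorem occ_le_add_sum {V : Type} {M : ℕ} {P : Arm M × (V → ℝ) → History V M → Prop}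
    {h : History V M} {w : ℕ → ℝ} (hw : ∀ s, 0 ≤ w s) (s₁ : ℕ)
    (H : ∀ e h', e :: h' <:+ h → P e h' → s₁ ≤ h'.length → 1 ≤ w h'.length) :
    (occ P h : ℝ) ≤ s₁ + ∑ s ∈ Finset.range h.length, w s := by
  suffices K : (occ P h : ℝ) ≤ (min s₁ h.length : ℕ) + ∑ s ∈ Finset.range h.length, w s by
    refine K.trans ?_
    gcongr
    exact min_le_left _ _
  induction h with
  | nil => simp [occ]
  | cons e h ih =>
    have ih := ih fun e' h' hs => H e' h' (hs.trans (List.suffix_cons _ _))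
    have H := H e h List.suffix_rfl
    rw [List.length_cons, Finset.sum_range_succ]
    unfold occ
    have hm : min s₁ h.length ≤ min s₁ (h.length + 1) := min_le_min_left _ (Nat.le_succ _)
    have hm' : ((min s₁ h.length : ℕ) : ℝ) ≤ (min s₁ (h.length + 1) : ℕ) := by exact_mod_cast hm
    have hw' := hw h.length
    by_cases hP : P e h
    · rw [if_pos hP]
      push_cast [-Nat.cast_min]
      by_cases hs : s₁ ≤ h.length
      · linarith [H hP hs]
      · have e1 : min s₁ h.length + 1 = min s₁ (h.length + 1) := by omega
        have e2 : ((min s₁ h.length : ℕ) : ℝ) + 1 = (min s₁ (h.length + 1) : ℕ) := by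
          exact_mod_cast e1
        linarith
    · rw [if_neg hP]
      simp only [add_zero]
      linarith

/-! ### Optimal arms are sampled linearly often -/

theorem eventually_log_le (c : ℝ) {ε : ℝ} (hε : 0 < ε) :
    ∀ᶠ s : ℕ in Filter.atTop, c + c * Real.log s + c * Real.log s ^ 2 ≤ ε * s := by
  have ho : (fun x : ℝ => c + c * Real.log x + c * Real.log x ^ 2) =o[Filter.atTop] (id : ℝ → ℝ) := by
    refine ((Asymptotics.isLittleO_const_id_atTop c).add ?_).add ?_
    · exact Real.isLittleO_log_id_atTop.const_mul_left c
    · exact (Real.isLittleO_pow_log_id_atTop (n := 2)).const_mul_left c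
  have h1 := (ho.bound hε)
  have h2 := tendsto_natCast_atTop_atTop (R := ℝ) |>.eventually h1
  filter_upwards [h2] with s hs
  refine (Real.le_norm_self _).trans (hs.trans (le_of_eq ?_))
  simp

/-- Every round is early (first half), a forced observation, a low-budget round, or an index round.
The first three kinds leave a linear number of rounds over. In an index round the pulled arm has at
most 9γ² times the samples of b, which caps its pulls of this kind. -/
theorem length_le_of_accurate (hγ : 1 ≤ γ) (htie : IsSelection tie)
    (hr : S.Reachable (S.crmNB γ B tie) h) (hcost : cost γ h ≤ B) {b : Arm M}
    (hopt : ∀ a, S.v γ a ≤ S.v γ b) (hlen : 4 * M + 4 ≤ h.length)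
    (hacc : ∀ h', h' <:+ h → h.length ≤ 2 * h'.length → S.Accurate h') :
    (h.length : ℝ) ≤ (h.length + 1) / 2 + ((1 + Real.log h.length) * Real.log h.length + 1) + γ +
      (2 * M + 1) * (9 * γ ^ 2 * S.effPulls b h + 1) := by
  set L := Real.log h.length with hL
  have hL0 : 0 ≤ L := Real.log_natCast_nonneg _
  have hq : 0 ≤ (1 + L) * L := by positivity
  let P1 : Arm M × (V → ℝ) → History V M → Prop := fun _ h' => h'.length < (h.length + 1) / 2
  let P2 : Arm M × (V → ℝ) → History V M → Prop := fun e h' =>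
    e.1 = obsArm ∧ (S.effPulls obsArm h' : ℝ) ≤ (1 + L) * L
  let P3 : Arm M × (V → ℝ) → History V M → Prop := fun _ h' => B - cost γ h' < γ
  let P4 : Arm M × (V → ℝ) → History V M → Prop := fun e h' =>
    (S.effPulls e.1 h' : ℝ) ≤ 9 * γ ^ 2 * S.effPulls b h
  have b1 : (occ P1 h : ℝ) ≤ (h.length + 1) / 2 :=
    (Nat.cast_le.2 (occ_length_lt _)).trans ((Nat.cast_div_le).trans (by push_cast; rfl))
  have b2 : (occ P2 h : ℝ) ≤ (1 + L) * L + 1 := by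
    refine occ_le_add_one hq fun e h' _ hP => le_trans ?_ hP.2
    rw [effPulls_obs]
    have : occ P2 h' ≤ pulls obsArm h' := occ_le_of_imp fun _ _ _ h => h.1
    exact_mod_cast this
  have b3 : (occ P3 h : ℝ) ≤ γ := occ_low_budget_le hγ (by linarith) hcost
  have b4 : (occ P4 h : ℝ) ≤ (2 * M + 1) * (9 * γ ^ 2 * S.effPulls b h + 1) := by
    have e1 : (occ P4 h : ℝ) ≤ ∑ a : Arm M, (occ (fun e h' => e.1 = a ∧ P4 e h') h : ℝ) := by
      exact_mod_cast occ_le_sum_arm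
    refine e1.trans ((Finset.sum_le_sum (g := fun _ => 9 * γ ^ 2 * S.effPulls b h + 1)
      fun a _ => ?_).trans (le_of_eq ?_))
    · refine occ_le_add_one (by positivity) fun e h' _ hP => ?_
      have e2 : occ (fun e h' => e.1 = a ∧ P4 e h') h' ≤ S.effPulls a h' :=
        (occ_le_of_imp fun _ _ _ h => h.1).trans (pulls_le_effPulls a h')
      refine (Nat.cast_le.2 e2).trans ?_
      obtain ⟨rfl, hP⟩ := hP
      exact hP
    · rw [Finset.sum_const, Finset.card_univ, card_arm, nsmul_eq_mul]
      push_cast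
      ring
  have htot : h.length ≤ occ P1 h + (occ P2 h + (occ P3 h + occ P4 h)) := by
    rw [← occ_true]
    refine (occ_le_add (Q := P1) (R := fun e h' => P2 e h' ∨ P3 e h' ∨ P4 e h') ?_).trans
      (Nat.add_le_add_left ((occ_le_add (Q := P2) (R := fun e h' => P3 e h' ∨ P4 e h')
        fun _ _ _ h => h).trans (Nat.add_le_add_left (occ_le_add fun _ _ _ h => h) _)) _)
    intro e h' hs _
    by_cases h1 : h'.length < (h.length + 1) / 2
    · exact Or.inl h1
    · right
      have hs' : h' <:+ h := (List.suffix_cons e h').trans hs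
      have hlt : h'.length + 1 ≤ h.length := by simpa using hs.length_le
      have hr' := hr.suffix hs
      have hM : 2 * M + 1 ≤ h'.length := by omega
      rcases (step_cases htie hr' hM).2 with ⟨ho, hN⟩ | ⟨ho, hb⟩ | ⟨-, -, hu⟩
      · refine Or.inl ⟨ho, hN.le.trans ?_⟩
        have l1 : Real.log h'.length ≤ L := log_natCast_mono (by omega)
        have l2 : Real.log (h'.length + 1) ≤ L := by
          have := log_natCast_mono hlt
          push_cast at this
          exact this
        have l3 : 0 ≤ Real.log ((h'.length : ℝ) + 1) :=
          Real.log_nonneg (by linarith [(Nat.cast_nonneg h'.length : (0 : ℝ) ≤ _)])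
        exact mul_le_mul ((beta_sq_le γ h').trans (by linarith)) l2 l3 (by linarith)
      · exact Or.inr (Or.inl hb)
      · right; right
        have hrh := hr.suffix hs'
        refine ((hacc h' hs' (by omega)).effPulls_le_mul hγ (hopt _)
          (effPulls_pos htie hrh hM _) (effPulls_pos htie hrh hM _) (by omega) (hu b)).trans ?_
        gcongr
        exact effPulls_mono hs' b
  have : (h.length : ℝ) ≤ occ P1 h + (occ P2 h + (occ P3 h + occ P4 h)) := by exact_mod_cast htot
  linarith

/-- While the estimates are accurate, an optimal arm gets linearly many samples. -/
theorem exists_linear_growth (M : ℕ) (hγ : 1 ≤ γ) : ∃ κ : ℝ, 0 < κ ∧ ∀ᶠ s : ℕ in Filter.atTop,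
    ∀ (V : Type) [Fintype V] [DecidableEq V] (S : NBModel V M) (B : ℝ)
      (tie : History V M → Finset (Arm M) → Arm M) (h h' : History V M) (b : Arm M),
      IsSelection tie → S.Reachable (S.crmNB γ B tie) h → 1 + 2 * M * γ ≤ B →
      (∀ a, S.v γ a ≤ S.v γ b) → h' <:+ h → h'.length = s → S.badness s h < 1 →
      κ * s ≤ S.effPulls b h' := by
  have hγ0 : 0 < γ := by linarith
  set K : ℝ := (2 * M + 1) * (9 * γ ^ 2) with hK
  have hK0 : 0 < K := by positivity
  -- The length bound reads s/2 − O(log² s) ≤ K·E_b, and half of the left side is kept.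
  refine ⟨1 / (4 * K), by positivity, ?_⟩
  set c : ℝ := 2 + γ + 2 * M + 1 with hc
  have hc1 : 1 ≤ c := by
    have : (0 : ℝ) ≤ 2 * M := by positivity
    linarith
  filter_upwards [eventually_log_le c (by norm_num : (0 : ℝ) < 1 / 4),
    Filter.eventually_ge_atTop (4 * M + 4)] with s hs hsM
  intro V _ _ S B tie h h' b htie hr hB hopt hs' hlen hbad
  have hr' := hr.suffix hs'
  have h1 := length_le_of_accurate hγ htie hr' (crmNB_withinBudget hγ hB htie h' hr') hopt
    (by omega) (fun h'' hs'' hl => accurate_of_badness_lt htie hr (hs''.trans hs') (by omega)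
      (by omega : s ≤ 2 * h''.length) (hlen ▸ hs''.length_le) hbad)
  rw [hlen] at h1
  set L := Real.log s
  have hL0 : 0 ≤ L := Real.log_natCast_nonneg _
  have h2 : (s : ℝ) / 4 ≤ K * S.effPulls b h' := by
    have e1 : L ≤ c * L := le_mul_of_one_le_left hL0 hc1
    have e2 : L ^ 2 ≤ c * L ^ 2 := le_mul_of_one_le_left (sq_nonneg L) hc1
    have e3 : (2 * (M : ℝ) + 1) * (9 * γ ^ 2 * S.effPulls b h' + 1) =
      K * S.effPulls b h' + (2 * M + 1) := by
      rw [hK]; ring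
    rw [e3] at h1
    nlinarith
  rw [div_mul_eq_mul_div, one_mul, div_le_iff₀ (by positivity)]
  linarith

end

/-! ### From pathwise counts to expectations -/

section

variable {V : Type} [Fintype V] [DecidableEq V] {M : ℕ} {S : NBModel V M}
  {π : Policy V M} {h : History V M} {γ B : ℝ} {tie : History V M → Finset (Arm M) → Arm M}

theorem WithinBudget.length_le (hγ : 1 ≤ γ) (hπ : S.WithinBudget γ B π)
    (hr : S.Reachable π h) : h.length ≤ ⌊B⌋₊ :=
  Nat.le_floor ((length_le_cost hγ h).trans (hπ h hr))

/-- The length of a run is random but at most N. By nonnegativity the sum extends to all s < N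
before expectations are taken, and then to the full series, so the bound does not depend on the
horizon. -/
theorem expect_le_of_pathwise {N : ℕ} {f g : History V M → ℝ} {w : ℕ → History V M → ℝ}
    {u : ℕ → ℝ} {c : ℝ} (hw : ∀ s h, 0 ≤ w s h) (hu : Summable u)
    (hE : ∀ s, S.expect π (w s) N [] ≤ u s)
    (hlen : ∀ h, S.Reachable π h → h.length ≤ N)
    (H : ∀ h, S.Final π N h → f h ≤ c + g h + ∑ s ∈ Finset.range h.length, w s h) :
    S.expect π f N [] ≤ c + S.expect π g N [] + ∑' s, u s := by
  have hu0 : ∀ s, 0 ≤ u s := fun s => by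
    refine le_trans ?_ (hE s)
    rw [← expect_const (S := S) (π := π) 0 N []]
    exact expect_mono fun h _ => hw s h
  have h1 : S.expect π f N [] ≤
      S.expect π (fun h => (c + g h) + ∑ s ∈ Finset.range N, w s h) N [] := by
    refine expect_mono fun h hf => (H h hf).trans ?_
    exact add_le_add_right (Finset.sum_le_sum_of_subset_of_nonneg
      (Finset.range_mono (hlen h hf.1)) fun _ _ _ => hw _ _) _
  rw [expect_add, expect_add, expect_const, expect_sum] at h1
  refine h1.trans ?_
  gcongr
  exact (Finset.sum_le_sum fun s _ => hE s).trans (hu.sum_le_tsum _ fun s _ => hu0 s)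

/-! ### The observational arm is optimal -/

/-- Bounds the indicator of the event that `X i = x` was seen too rarely, given that there were
at least `κ s` observational rounds. -/
def rareness (S : NBModel V M) (i : Fin M) (x : Fin 2) (κ : ℝ) (s : ℕ) (h : History V M) : ℝ :=
  ∑ n ∈ (Finset.range (s + 1)).filter (fun n : ℕ => κ * s ≤ (n : ℝ)),
    ind (Deviates (S.IsSample obsArm) (S.seen i x) (S.p i x) n (S.p i x / 2) h)

theorem rareness_nonneg (i : Fin M) (x : Fin 2) (κ : ℝ) (s : ℕ) (h : History V M) :
    0 ≤ S.rareness i x κ s h := Finset.sum_nonneg fun _ _ => ind_nonneg _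

theorem expect_rareness_le (i : Fin M) (x : Fin 2) (κ : ℝ) (s N : ℕ) :
    S.expect π (S.rareness i x κ s) N [] ≤
      2 * ((s : ℝ) ^ 1 * Real.exp (-(κ * S.p i x ^ 2 / 2) * s) +
        (s : ℝ) ^ 0 * Real.exp (-(κ * S.p i x ^ 2 / 2) * s)) := by
  unfold rareness
  rw [expect_sum]
  have hp := S.p_pos i x
  have key : ∀ n ∈ (Finset.range (s + 1)).filter (fun n : ℕ => κ * s ≤ (n : ℝ)),
      S.expect π (fun h => ind (Deviates (S.IsSample obsArm) (S.seen i x) (S.p i x) n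
        (S.p i x / 2) h)) N [] ≤ 2 * Real.exp (-(κ * S.p i x ^ 2 / 2) * s) := by
    intro n hn
    refine ((samplesOf_obs i x).expect_ind_deviates_le n N (by positivity)).trans ?_
    gcongr
    have := mul_le_mul_of_nonneg_right (Finset.mem_filter.1 hn).2 (sq_nonneg (S.p i x))
    nlinarith
  refine (Finset.sum_le_sum key).trans ?_
  rw [Finset.sum_const, nsmul_eq_mul]
  have hcard : (((Finset.range (s + 1)).filter (fun n : ℕ => κ * s ≤ (n : ℝ))).card : ℝ) ≤ s + 1 := by
    have := Finset.card_filter_le (Finset.range (s + 1)) (fun n : ℕ => κ * s ≤ (n : ℝ))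
    rw [Finset.card_range] at this
    exact_mod_cast this
  refine (mul_le_mul_of_nonneg_right hcard (by positivity)).trans (le_of_eq ?_)
  ring

theorem summable_rareness_bound {r : ℝ} (hr : 0 < r) : Summable fun s : ℕ =>
    2 * ((s : ℝ) ^ 1 * Real.exp (-r * s) + (s : ℝ) ^ 0 * Real.exp (-r * s)) :=
  ((Real.summable_pow_mul_exp_neg_nat_mul 1 hr).add
    (Real.summable_pow_mul_exp_neg_nat_mul 0 hr)).mul_left 2

theorem obsCount_ge_of_rareness_lt {i : Fin M} {x : Fin 2} {κ : ℝ} {s : ℕ} {h' : History V M}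
    (hs : h' <:+ h) (hlen : h'.length = s) (hN : κ * s ≤ S.effPulls obsArm h')
    (hb : S.rareness i x κ s h < 1) :
    S.p i x / 2 * S.effPulls obsArm h' ≤ S.obsCount i x h' := by
  by_contra hlt
  rw [not_le] at hlt
  have hdev := deviates_of_obsCount_lt (c := S.p i x / 2) hs (by
    rw [sub_half]; exact hlt)
  refine hb.not_ge ?_
  rw [← ind_of hdev]
  exact Finset.single_le_sum (f := fun n : ℕ => ind (Deviates (S.IsSample obsArm) (S.seen i x)
    (S.p i x) n (S.p i x / 2) h)) (fun _ _ => ind_nonneg _) (Finset.mem_filter.2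
    ⟨Finset.mem_range.2 (Nat.lt_succ_of_le (hlen ▸ effPulls_le_length _ _)), hN⟩)

/-- If the observational arm is optimal, a suboptimal arm is pulled boundedly often. -/
theorem exists_expect_pulls_le (S : NBModel V M) (hγ : 1 ≤ γ)
    (hopt : ∀ a, S.v γ a ≤ S.v γ obsArm) (i : Fin M) (x : Fin 2)
    (hd : 0 < S.d γ obsArm (intArm i x)) :
    ∃ C, ∀ B, 1 + 2 * M * γ ≤ B → ∀ tie, IsSelection tie →
      S.expect (S.crmNB γ B tie) (fun h => (pulls (intArm i x) h : ℝ)) ⌊B⌋₊ [] ≤ C := by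
  obtain ⟨κ, hκ, hgrow⟩ := exists_linear_growth M hγ
  have hp := S.p_pos i x
  set D : ℝ := (γ * S.d γ obsArm (intArm i x)) ^ 2 with hD
  have hD0 : 0 < D := by
    have : 0 < γ := by linarith
    positivity
  -- Past `s₁`, the quota 18 log s is below the D·(p/2)·κ·s guaranteed by observations; the final
  -- halving makes the inequality strict.
  have hev := (eventually_log_le 18 (by positivity : 0 < D * (S.p i x / 2 * κ) / 2)).and
    (hgrow.and (Filter.eventually_ge_atTop (2 * M + 1)))
  obtain ⟨s₁, hs₁⟩ := Filter.eventually_atTop.1 hev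
  set u : ℕ → ℝ := fun s => 32 * (2 * (M : ℝ) + 1) * (1 / (s : ℝ) ^ 2) +
    2 * ((s : ℝ) ^ 1 * Real.exp (-(κ * S.p i x ^ 2 / 2) * s) +
        (s : ℝ) ^ 0 * Real.exp (-(κ * S.p i x ^ 2 / 2) * s)) with hu
  refine ⟨s₁ + 0 + ∑' s, u s, fun B hB tie htie => ?_⟩
  have hw := crmNB_withinBudget (S := S) hγ hB htie
  rw [← expect_const (S := S) (π := S.crmNB γ B tie) 0 ⌊B⌋₊ []]
  refine expect_le_of_pathwise (w := fun s h => S.badness s h + S.rareness i x κ s h)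
    (fun s h => add_nonneg (badness_nonneg _ _) (rareness_nonneg _ _ _ _ _))
    ((summable_badness_bound M).add (summable_rareness_bound (by positivity)))
    (fun s => by
      rw [expect_add]
      exact add_le_add (expect_badness_le _ _) (expect_rareness_le _ _ _ _ _))
    (fun h hr => hw.length_le hγ hr) (fun h hf => ?_)
  rw [add_zero]
  refine occ_le_add_sum (fun s => add_nonneg (badness_nonneg _ _) (rareness_nonneg _ _ _ _ _)) s₁
    fun e h' hs he hlen => ?_
  -- If neither bad event occurs, there are at least κs observations, hence (p/2)κs samples for this
  -- arm. This contradicts its having the largest index.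
  by_contra hlt
  rw [not_le] at hlt
  have hb1 : S.badness h'.length h < 1 := by
    linarith [rareness_nonneg (S := S) i x κ h'.length h]
  have hb2 : S.rareness i x κ h'.length h < 1 := by
    linarith [badness_nonneg (S := S) h'.length h]
  have hs' : h' <:+ h := (List.suffix_cons e h').trans hs
  obtain ⟨hlog, hg, hM⟩ := hs₁ _ hlen
  have hN := hg V S B tie h h' obsArm htie hf.1 hB hopt hs' rfl hb1
  have hO := obsCount_ge_of_rareness_lt hs' rfl hN hb2
  have hne : e.1 ≠ obsArm := by rw [he]; simp
  have hacc := accurate_of_badness_lt htie hf.1 hs' hM (by omega) le_rfl hb1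
  have hpos := effPulls_pos htie (hf.1.suffix hs') hM (intArm i x)
  rcases (step_cases htie (hf.1.suffix hs) hM).2 with ⟨ho, -⟩ | ⟨ho, -⟩ | ⟨-, -, hucb⟩
  · exact hne ho
  · exact hne ho
  · rw [he] at hucb
    have h1 := hacc.effPulls_le hγ (hopt _) hpos (hucb obsArm)
    rw [show armCost γ (intArm i x) = γ from if_neg (by simp), ← hD] at h1
    have h2 : (S.obsCount i x h' : ℝ) ≤ S.effPulls (intArm i x) h' := by
      rw [effPulls_int]
      push_cast
      linarith [(Nat.cast_nonneg (pulls (intArm i x) h') : (0 : ℝ) ≤ _)]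
    have h3 : D * (S.p i x / 2 * (κ * h'.length)) ≤ D * S.effPulls (intArm i x) h' := by
      refine mul_le_mul_of_nonneg_left (le_trans ?_ (hO.trans h2)) hD0.le
      exact mul_le_mul_of_nonneg_left hN (by positivity)
    have hlen0 : (0 : ℝ) < h'.length := by
      exact_mod_cast (by omega : 0 < h'.length)
    have h4 : 0 < D * (S.p i x / 2 * κ) / 2 * h'.length := by positivity
    have h5 : 0 ≤ Real.log h'.length ^ 2 := sq_nonneg _
    nlinarith

/-! ### An intervention is optimal -/

/-- A positive estimated gap means that β was updated in the latest round, so no older value of β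
matters. -/
theorem beta_eq_of_gap (hlen : 2 * M + 2 ≤ h.length) {g : ℝ} (hg : 0 < g)
    (hgap : g ≤ S.muHatMax h / γ - S.muHat obsArm h) :
    S.beta γ h = min (2 * √2 / (S.muHatMax h / γ - S.muHat obsArm h)) √(Real.log h.length) := by
  rcases h with _ | ⟨e, h⟩
  · simp at hlen
  · rw [beta, if_pos ⟨hlen, by linarith⟩]

theorem beta_sq_le_of_gap (hlen : 2 * M + 2 ≤ h.length) {g : ℝ} (hg : 0 < g)
    (hgap : g ≤ S.muHatMax h / γ - S.muHat obsArm h) : S.beta γ h ^ 2 ≤ 8 / g ^ 2 := by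
  have h1 : S.beta γ h ≤ 2 * √2 / g := by
    rw [beta_eq_of_gap hlen hg hgap]
    exact (min_le_left _ _).trans (div_le_div_of_nonneg_left (by positivity) hg hgap)
  refine (pow_le_pow_left₀ (beta_nonneg γ h) h1 2).trans (le_of_eq ?_)
  rw [div_pow, mul_pow, Real.sq_sqrt zero_le_two]
  norm_num

/-- The condition on the logarithm ensures that the cap √(log t) is not what limits β. -/
theorem le_beta_sq_of_gap (hlen : 2 * M + 2 ≤ h.length) {g g' : ℝ} (hg : 0 < g)
    (hgap : g ≤ S.muHatMax h / γ - S.muHat obsArm h)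
    (hgap' : S.muHatMax h / γ - S.muHat obsArm h ≤ g') (hlog : 8 / g' ^ 2 ≤ Real.log h.length) :
    8 / g' ^ 2 ≤ S.beta γ h ^ 2 := by
  have hg' : 0 < g' := by linarith
  rw [← Real.sqrt_le_left (beta_nonneg γ h), beta_eq_of_gap hlen hg hgap]
  refine le_min ?_ (Real.sqrt_le_sqrt hlog)
  have e : √(8 / g' ^ 2) = 2 * √2 / g' := by
    rw [show (8 : ℝ) / g' ^ 2 = 2 ^ 2 * 2 / g' ^ 2 by norm_num, Real.sqrt_div (by norm_num),
      Real.sqrt_mul (by norm_num), Real.sqrt_sq (by norm_num), Real.sqrt_sq hg'.le]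
  rw [e]
  exact div_le_div_of_nonneg_left (by positivity) (by linarith) hgap'

theorem v_obs (S : NBModel V M) (γ : ℝ) : S.v γ obsArm = S.mu obsArm := by
  simp [v, armCost]

theorem v_int (S : NBModel V M) (γ : ℝ) (i : Fin M) (x : Fin 2) :
    S.v γ (intArm i x) = S.mu (intArm i x) / γ := by
  simp [v, armCost]

theorem gap_ge (hγ : 1 ≤ γ) {i : Fin M} {x : Fin 2} {ε : ℝ} (hε : 0 ≤ ε)
    (h0 : S.muHat obsArm h ≤ S.mu obsArm + ε)
    (h1 : S.mu (intArm i x) - ε ≤ S.muHat (intArm i x) h) :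
    S.d γ (intArm i x) obsArm - 2 * ε ≤ S.muHatMax h / γ - S.muHat obsArm h := by
  have hγ0 : 0 < γ := by linarith
  have h2 := h1.trans (muHat_le_muHatMax (i, x) h)
  have h3 : S.v γ (intArm i x) - ε ≤ S.muHatMax h / γ := by
    refine le_trans ?_ (div_le_div_of_nonneg_right h2 hγ0.le)
    rw [sub_div, v_int]
    linarith [div_le_self hε hγ]
  unfold d
  rw [v_obs]
  linarith

/-- Any intervention might attain the empirical maximum, so all their estimates must be controlled
here, whereas `gap_ge` needs only one. -/
theorem gap_le (hγ : 1 ≤ γ) {aStar : Arm M} (hopt : ∀ a, S.v γ a ≤ S.v γ aStar) {ε : ℝ}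
    (hε : 0 ≤ ε) (h0 : S.mu obsArm - ε ≤ S.muHat obsArm h)
    (h1 : ∀ i x, S.muHat (intArm i x) h ≤ S.mu (intArm i x) + ε) :
    S.muHatMax h / γ - S.muHat obsArm h ≤ S.d γ aStar obsArm + 2 * ε := by
  have hγ0 : 0 < γ := by linarith
  have h2 : S.muHatMax h ≤ γ * (S.v γ aStar + ε) := by
    refine muHatMax_le (mul_nonneg hγ0.le (add_nonneg (v_nonneg hγ _) hε)) fun i x => ?_
    refine (h1 i x).trans ?_
    have := hopt (intArm i x)
    rw [v_int, div_le_iff₀ hγ0] at this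
    nlinarith
  have h3 : S.muHatMax h / γ ≤ S.v γ aStar + ε := by
    rw [div_le_iff₀ hγ0]
    linarith
  unfold d
  rw [v_obs]
  linarith

theorem rad_le_of_le {a : Arm M} {ε : ℝ} (hε : 0 < ε) (hpos : 0 < S.effPulls a h)
    (H : 2 * Real.log h.length / ε ^ 2 ≤ S.effPulls a h) : S.rad a h ≤ ε := by
  have hE : (0 : ℝ) < S.effPulls a h := by exact_mod_cast hpos
  refine Real.sqrt_le_iff.2 ⟨hε.le, ?_⟩
  rw [div_le_iff₀ (by positivity)] at H
  rw [div_le_iff₀ hE]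
  linarith

/-- The number of observations if an intervention is optimal. -/
theorem exists_expect_pulls_obs_le (S : NBModel V M) (hγ : 1 ≤ γ) {i : Fin M} {x : Fin 2}
    (hopt : ∀ a, S.v γ a ≤ S.v γ (intArm i x)) (hd : 0 < S.d γ (intArm i x) obsArm) :
    ∃ C, ∀ B, 1 + 2 * M * γ ≤ B → ∀ tie, IsSelection tie →
      S.expect (S.crmNB γ B tie) (fun h => (pulls obsArm h : ℝ)) ⌊B⌋₊ [] ≤
        C + 32 * Real.log B / S.d γ (intArm i x) obsArm ^ 2 := by
  obtain ⟨κ, hκ, hgrow⟩ := exists_linear_growth M hγ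
  set δ := S.d γ (intArm i x) obsArm with hδ
  have hev := (eventually_log_le (32 / δ ^ 2) hκ).and
    (hgrow.and (Filter.eventually_ge_atTop (2 * M + 2)))
  obtain ⟨s₁, hs₁⟩ := Filter.eventually_atTop.1 hev
  refine ⟨s₁ + 1 + γ + ∑' s : ℕ, 32 * (2 * (M : ℝ) + 1) * (1 / (s : ℝ) ^ 2),
    fun B hB tie htie => ?_⟩
  have hw := crmNB_withinBudget (S := S) hγ hB htie
  have hB1 : 1 ≤ B := by
    have : 0 ≤ 2 * M * γ := by positivity
    linarith
  -- Beyond m observations the radius of a_0 is at most δ/4, and linear growth gives the same for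
  -- the optimal arm. The gap is then at least δ/2 and β² ≤ 8/(δ/2)² = 32/δ², so exploration demands
  -- at most m. The index rule stops even earlier, as 18 < 32. Late observations beyond m thus need
  -- low budget or an inaccurate estimate.
  set m := 32 * Real.log B / δ ^ 2 with hm
  have hm0 : 0 ≤ m := div_nonneg (mul_nonneg (by norm_num) (Real.log_nonneg hB1)) (sq_nonneg _)
  refine (expect_le_of_pathwise (w := fun s h => S.badness s h) (c := s₁ + 1 + γ + m)
    (g := fun _ => 0) badness_nonneg (summable_badness_bound M) (fun s => expect_badness_le _ _)
    (fun h hr => hw.length_le hγ hr) (fun h hf => ?_)).trans (le_of_eq (by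
      rw [expect_const]; ring))
  let P1 : Arm M × (V → ℝ) → History V M → Prop := fun e h' =>
    e.1 = obsArm ∧ (S.effPulls obsArm h' : ℝ) ≤ m
  let P2 : Arm M × (V → ℝ) → History V M → Prop := fun _ h' => B - cost γ h' < γ
  let P3 : Arm M × (V → ℝ) → History V M → Prop := fun e h' =>
    e.1 = obsArm ∧ m < (S.effPulls obsArm h' : ℝ) ∧ γ ≤ B - cost γ h'
  have b1 : (occ P1 h : ℝ) ≤ m + 1 := by
    refine occ_le_add_one hm0 fun e h' _ hP => le_trans ?_ hP.2
    rw [effPulls_obs]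
    have : occ P1 h' ≤ pulls obsArm h' := occ_le_of_imp fun _ _ _ h => h.1
    exact_mod_cast this
  have b2 : (occ P2 h : ℝ) ≤ γ := occ_low_budget_le hγ (by linarith) (hw h hf.1)
  have htot : pulls obsArm h ≤ occ P1 h + (occ P2 h + occ P3 h) := by
    refine (occ_le_add (Q := P1) (R := fun e h' => P2 e h' ∨ P3 e h') ?_).trans
      (Nat.add_le_add_left (occ_le_add fun _ _ _ h => h) _)
    intro e h' _ he
    by_cases h1 : (S.effPulls obsArm h' : ℝ) ≤ m
    · exact Or.inl ⟨he, h1⟩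
    · by_cases h2 : B - cost γ h' < γ
      · exact Or.inr (Or.inl h2)
      · exact Or.inr (Or.inr ⟨he, not_le.1 h1, not_lt.1 h2⟩)
  have b3 : (occ P3 h : ℝ) ≤ s₁ + ∑ s ∈ Finset.range h.length, S.badness s h := by
    refine occ_le_add_sum (fun s => badness_nonneg _ _) s₁ fun e h' hs he hlen => ?_
    by_contra hlt
    rw [not_le] at hlt
    obtain ⟨he, hmN, hbud⟩ := he
    have hs' : h' <:+ h := (List.suffix_cons e h').trans hs
    obtain ⟨hlog, hg, hM⟩ := hs₁ _ hlen
    have hN := hg V S B tie h h' (intArm i x) htie hf.1 hB hopt hs' rfl hlt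
    have hacc := accurate_of_badness_lt htie hf.1 hs' (by omega) (by omega) le_rfl hlt
    have hpos := effPulls_pos htie (hf.1.suffix hs') (by omega : 2 * M + 1 ≤ h'.length)
    have hlt1 : ((h'.length : ℝ) + 1) ≤ B := by
      have h1 : (e :: h').length ≤ h.length := hs.length_le
      have h2 := (length_le_cost hγ h).trans (hw h hf.1)
      have h3 : ((e :: h').length : ℝ) ≤ h.length := by exact_mod_cast h1
      rw [List.length_cons] at h3
      push_cast at h3
      linarith
    have hlen0 : (0 : ℝ) < h'.length := by
      exact_mod_cast (by omega : 0 < h'.length)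
    have hL1 : Real.log (h'.length + 1) ≤ Real.log B := Real.log_le_log (by linarith) hlt1
    have hL2 : Real.log h'.length ≤ Real.log (h'.length + 1) :=
      Real.log_le_log hlen0 (by linarith)
    have hL0 : 0 ≤ Real.log h'.length := Real.log_natCast_nonneg _
    have hN0 : 32 * Real.log B < S.effPulls obsArm h' * δ ^ 2 := by
      rwa [hm, div_lt_iff₀ (by positivity)] at hmN
    rcases (step_cases htie (hf.1.suffix hs) (by omega)).2 with ⟨-, hβ⟩ | ⟨-, hc⟩ | ⟨-, -, hucb⟩
    · have r0 : S.rad obsArm h' ≤ δ / 4 := rad_le_of_le (by positivity) (hpos _) (by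
        rw [div_le_iff₀ (by positivity)]
        linarith)
      have r1 : S.rad (intArm i x) h' ≤ δ / 4 := rad_le_of_le (by positivity) (hpos _) (by
        refine le_trans ?_ hN
        refine le_trans ?_ hlog
        have e1 : 2 * Real.log h'.length / (δ / 4) ^ 2 = 32 / δ ^ 2 * Real.log h'.length := by
          field_simp
          ring
        rw [e1]
        have : 0 ≤ 32 / δ ^ 2 := by positivity
        have : 0 ≤ 32 / δ ^ 2 * Real.log h'.length ^ 2 := by positivity
        linarith)
      have hgap := gap_ge (S := S) (h := h') (i := i) (x := x) hγ (by positivity : 0 ≤ δ / 4)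
        (by linarith [(abs_le.1 (hacc obsArm)).2])
        (by linarith [(abs_le.1 (hacc (intArm i x))).1])
      have hβ2 := beta_sq_le_of_gap (S := S) (γ := γ) (h := h') hM (by positivity : 0 < δ / 2) (by linarith)
      have e2 : 8 / (δ / 2) ^ 2 = 32 / δ ^ 2 := by
        field_simp
        norm_num
      rw [e2] at hβ2
      have h3 : S.beta γ h' ^ 2 * Real.log (h'.length + 1) ≤ 32 / δ ^ 2 * Real.log B :=
        mul_le_mul hβ2 hL1 (by linarith) (by positivity)
      have h4 : 32 / δ ^ 2 * Real.log B = m := by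
        rw [hm]; ring
      linarith
    · linarith
    · rw [he] at hucb
      have h1 := hacc.effPulls_le hγ (hopt _) (hpos obsArm) (hucb (intArm i x))
      rw [show armCost γ (obsArm : Arm M) = 1 from if_pos rfl, one_mul, ← hδ] at h1
      nlinarith
  have : (pulls obsArm h : ℝ) ≤ occ P1 h + (occ P2 h + occ P3 h) := by exact_mod_cast htot
  linarith

end

/-! ### Seen values and pulls of suboptimal interventions -/

section

variable {V : Type} [Fintype V] [DecidableEq V] {M : ℕ} {S : NBModel V M}
  {π : Policy V M} {h : History V M} {γ B : ℝ} {tie : History V M → Finset (Arm M) → Arm M}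

/-- Bounds the indicator of the event that, at some time with at least `k` samples, an estimate is
off by `ε` or some `X i = x` was seen too rarely. -/
def discrepancy (S : NBModel V M) (ε : ℝ) (k N : ℕ) (h : History V M) : ℝ :=
  ∑ n ∈ Finset.Ico k (N + 1),
    (∑ a, ind (Deviates (S.IsSample a) S.reward (S.mu a) n ε h) +
      ∑ ix : Fin M × Fin 2, ind (Deviates (S.IsSample obsArm) (S.seen ix.1 ix.2)
        (S.p ix.1 ix.2) n (S.p ix.1 ix.2 / 8) h))

theorem discrepancy_nonneg (ε : ℝ) (k N : ℕ) (h : History V M) : 0 ≤ S.discrepancy ε k N h :=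
  Finset.sum_nonneg fun _ _ => add_nonneg (Finset.sum_nonneg fun _ _ => ind_nonneg _)
    (Finset.sum_nonneg fun _ _ => ind_nonneg _)

theorem abs_sub_le_of_discrepancy_lt {ε : ℝ} {k N : ℕ} (hN : h.length ≤ N)
    (hd : S.discrepancy ε k N h < 1) {h' : History V M} (hs : h' <:+ h) {a : Arm M}
    (hpos : 0 < S.effPulls a h') (hk : k ≤ S.effPulls a h') :
    |S.muHat a h' - S.mu a| ≤ ε := by
  by_contra hlt
  rw [not_le] at hlt
  have hdev := deviates_of_lt hs hpos hlt
  refine hd.not_ge ?_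
  rw [← ind_of hdev]
  refine le_trans ?_ (Finset.single_le_sum (f := fun n : ℕ =>
    (∑ a, ind (Deviates (S.IsSample a) S.reward (S.mu a) n ε h) +
      ∑ ix : Fin M × Fin 2, ind (Deviates (S.IsSample obsArm) (S.seen ix.1 ix.2)
        (S.p ix.1 ix.2) n (S.p ix.1 ix.2 / 8) h)))
    (fun _ _ => add_nonneg (Finset.sum_nonneg fun _ _ => ind_nonneg _)
      (Finset.sum_nonneg fun _ _ => ind_nonneg _))
    (Finset.mem_Ico.2 ⟨hk, Nat.lt_succ_of_le
      ((effPulls_le_length a h').trans (hs.length_le.trans hN))⟩))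
  refine le_add_of_le_of_nonneg ?_ (Finset.sum_nonneg fun _ _ => ind_nonneg _)
  exact Finset.single_le_sum (f := fun b : Arm M => ind (Deviates (S.IsSample b) S.reward (S.mu b)
    (S.effPulls a h') ε h)) (fun _ _ => ind_nonneg _) (Finset.mem_univ a)

theorem obsCount_ge_of_discrepancy_lt {ε : ℝ} {k N : ℕ} (hN : h.length ≤ N)
    (hd : S.discrepancy ε k N h < 1) {h' : History V M} (hs : h' <:+ h) (i : Fin M) (x : Fin 2)
    (hk : k ≤ S.effPulls obsArm h') :
    7 / 8 * S.p i x * S.effPulls obsArm h' ≤ S.obsCount i x h' := by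
  by_contra hlt
  rw [not_le] at hlt
  have hlt' : (S.obsCount i x h' : ℝ) <
      (S.p i x - S.p i x / 8) * S.effPulls obsArm h' := hlt.trans_eq (by ring)
  have hdev := deviates_of_obsCount_lt hs hlt'
  refine hd.not_ge ?_
  have hmem : S.effPulls obsArm h' ∈ Finset.Ico k (N + 1) := Finset.mem_Ico.2 ⟨hk,
    Nat.lt_succ_of_le ((effPulls_le_length _ h').trans (hs.length_le.trans hN))⟩
  let F : ℕ → Fin M × Fin 2 → ℝ := fun n ix => ind (Deviates (S.IsSample obsArm)
    (S.seen ix.1 ix.2) (S.p ix.1 ix.2) n (S.p ix.1 ix.2 / 8) h)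
  have hF : ∀ n ix, 0 ≤ F n ix := fun _ _ => ind_nonneg _
  calc (1 : ℝ) = F (S.effPulls obsArm h') (i, x) := (ind_of hdev).symm
    _ ≤ ∑ ix, F (S.effPulls obsArm h') ix :=
      Finset.single_le_sum (fun ix _ => hF _ ix) (Finset.mem_univ (i, x))
    _ ≤ ∑ n ∈ Finset.Ico k (N + 1), ∑ ix, F n ix :=
      Finset.single_le_sum (f := fun n => ∑ ix, F n ix)
        (fun n _ => Finset.sum_nonneg fun ix _ => hF n ix) hmem
    _ ≤ S.discrepancy ε k N h := Finset.sum_le_sum fun n _ =>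
      le_add_of_nonneg_left (Finset.sum_nonneg fun _ _ => ind_nonneg _)

theorem summable_hoeffding {c : ℝ} (hc : 0 < c) :
    Summable fun n : ℕ => 2 * Real.exp (-(2 * n * c ^ 2)) := by
  have h := (Real.summable_exp_nat_mul_iff (a := -(2 * c ^ 2))).2 (by
    have : 0 < c ^ 2 := by positivity
    linarith)
  refine (h.congr fun n => ?_).mul_left 2
  congr 1
  ring

/-- The Hoeffding bounds for fixed accuracy are summable in n, so a tail is small. The threshold `k`
depends on the model alone, not on policy or horizon. -/
theorem exists_expect_discrepancy_le (S : NBModel V M) {ε : ℝ} (hε : 0 < ε) {η : ℝ} (hη : 0 < η) :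
    ∃ k : ℕ, ∀ (π : Policy V M) (N : ℕ), S.expect π (S.discrepancy ε k N) N [] ≤ η := by
  set g : ℕ → ℝ := fun n => ∑ _a : Arm M, 2 * Real.exp (-(2 * n * ε ^ 2)) +
    ∑ ix : Fin M × Fin 2, 2 * Real.exp (-(2 * n * (S.p ix.1 ix.2 / 8) ^ 2)) with hg
  have hsum : Summable g := (summable_sum fun _ _ => summable_hoeffding hε).add
    (summable_sum fun ix _ => summable_hoeffding (by
      have := S.p_pos ix.1 ix.2
      positivity))
  obtain ⟨s, hs⟩ := summable_iff_vanishing_norm.1 hsum η hη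
  refine ⟨s.sup id + 1, fun π N => ?_⟩
  have h1 : ∑ n ∈ Finset.Ico (s.sup id + 1) (N + 1), g n ≤ η := by
    refine (Real.le_norm_self _).trans (hs _ ?_).le
    rw [Finset.disjoint_left]
    intro n hn hns
    have := Finset.le_sup (f := id) hns
    rw [Finset.mem_Ico] at hn
    simp only [id_eq] at this
    omega
  refine le_trans ?_ h1
  unfold discrepancy
  rw [expect_sum]
  refine Finset.sum_le_sum fun n _ => ?_
  rw [expect_add, expect_sum, expect_sum]
  refine add_le_add (Finset.sum_le_sum fun a _ => ?_) (Finset.sum_le_sum fun ix _ => ?_)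
  · exact (samplesOf_isSample a).expect_ind_deviates_le n N hε.le
  · exact (samplesOf_obs ix.1 ix.2).expect_ind_deviates_le n N (by
      have := S.p_pos ix.1 ix.2
      positivity)

theorem log_succ_le {n : ℕ} (hn : 0 < n) : Real.log (n + 1) ≤ Real.log n + 1 / n := by
  have hn' : (0 : ℝ) < n := by exact_mod_cast hn
  have h := Real.log_le_sub_one_of_pos (by positivity : (0 : ℝ) < (n + 1) / n)
  rw [Real.log_div (by positivity) hn'.ne', add_div, div_self hn'.ne'] at h
  linarith

/-- The exploration rule makes the number of observations catch up with `θ log t`. -/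
theorem min_le_effPulls_obs (htie : IsSelection tie) {θ : ℝ} (hθ : 0 ≤ θ) {s₀ : ℕ}
    (hM : 2 * M + 1 ≤ s₀) (hθs : θ ≤ s₀) : ∀ {h : History V M},
      S.Reachable (S.crmNB γ B tie) h →
      (∀ h', h' <:+ h → s₀ ≤ h'.length → θ ≤ S.beta γ h' ^ 2) → s₀ ≤ h.length →
      min ((h.length : ℝ) - s₀) (θ * Real.log h.length) ≤ S.effPulls obsArm h
  | [], _, _, hlen => by
    simp at hlen
    omega
  | e :: h, hr, H, hlen => by
    rw [List.length_cons] at hlen ⊢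
    by_cases hs : s₀ ≤ h.length
    · have ih := min_le_effPulls_obs htie hθ hM hθs hr.of_cons.1
        (fun h' hs' => H h' (hs'.trans (List.suffix_cons _ _))) hs
      have hpos : 0 < h.length := by omega
      have hpos' : (0 : ℝ) < h.length := by exact_mod_cast hpos
      have hpull : e.1 = obsArm → min (((h.length + 1 : ℕ) : ℝ) - s₀)
          (θ * Real.log (h.length + 1 : ℕ)) ≤ S.effPulls obsArm (e :: h) := by
        intro ho
        have e1 : S.effPulls obsArm (e :: h) = S.effPulls obsArm h + 1 := by
          rw [effPulls_obs, effPulls_obs, pulls, occ, if_pos ho]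
        rw [e1]
        push_cast
        have hl := mul_le_mul_of_nonneg_left (log_succ_le hpos) hθ
        -- From time s₀ ≥ θ on, θ log t grows by at most 1 per round, so a single observation keeps
        -- pace with it.
        have h1 : θ * (1 / h.length) ≤ 1 := by
          rw [mul_one_div, div_le_one hpos']
          exact hθs.trans (by exact_mod_cast hs)
        refine le_trans ?_ (add_le_add_left ih 1)
        rw [min_add]
        refine min_le_min (by linarith) ?_
        rw [mul_add] at hl
        linarith
      rcases (step_cases htie hr (by omega)).2 with ⟨ho, -⟩ | ⟨ho, -⟩ | ⟨hN, -⟩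
      · exact hpull ho
      · exact hpull ho
      · refine (min_le_right _ _).trans ?_
        have h1 := H h (List.suffix_cons _ _) hs
        have h2 : 0 ≤ Real.log (h.length + 1) := Real.log_nonneg (by linarith)
        have h3 : (S.effPulls obsArm h : ℝ) ≤ S.effPulls obsArm (e :: h) := by
          exact_mod_cast effPulls_mono (List.suffix_cons _ _) _
        push_cast
        exact (mul_le_mul_of_nonneg_right h1 h2).trans (hN.trans h3)
    · have : h.length + 1 = s₀ := by omega
      refine (min_le_left _ _).trans ?_
      rw [this, sub_self]
      exact Nat.cast_nonneg _

/-- If an intervention is optimal and the estimates are good, the values of the intervenable nodes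
are seen often enough. -/
theorem exists_obsCount_ge (S : NBModel V M) (hγ : 1 ≤ γ) {i : Fin M} {x : Fin 2}
    (hopt : ∀ a, S.v γ a ≤ S.v γ (intArm i x)) (hd : 0 < S.d γ (intArm i x) obsArm) (k : ℕ) :
    ∃ s₂ : ℕ, ∀ (B : ℝ) (tie : History V M → Finset (Arm M) → Arm M) (h : History V M) (N : ℕ),
      IsSelection tie → S.Reachable (S.crmNB γ B tie) h → h.length ≤ N →
      S.discrepancy (S.d γ (intArm i x) obsArm / 32) k N h < 1 →
      ∀ h', h' <:+ h → s₂ ≤ h'.length → ∀ j z,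
        6 * S.p j z / S.d γ (intArm i x) obsArm ^ 2 * Real.log h'.length ≤ S.obsCount j z h' := by
  have hM : 1 ≤ M := Nat.one_le_iff_ne_zero.2 fun h0 => by
    subst h0
    exact i.elim0
  set δ := S.d γ (intArm i x) obsArm with hδ
  have hlogtop : Filter.Tendsto (fun s : ℕ => Real.log s) Filter.atTop Filter.atTop :=
    Real.tendsto_log_atTop.comp tendsto_natCast_atTop_atTop
  have hp : ∀ j z, 0 < S.p j z := S.p_pos
  have hev := (eventually_log_le (2 * M + 1 : ℝ) one_pos).and
    ((hlogtop.eventually_ge_atTop (k : ℝ)).and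
    ((hlogtop.eventually_ge_atTop (8 / (17 / 16 * δ) ^ 2)).and
    ((Filter.eventually_ge_atTop (2 * M + 2)).and
    (Filter.eventually_all.2 fun jz : Fin M × Fin 2 =>
      hlogtop.eventually_ge_atTop ((k : ℝ) / (7 / 8 * S.p jz.1 jz.2))))))
  obtain ⟨s_b, hs_b⟩ := Filter.eventually_atTop.1 hev
  -- With errors δ/32 the estimated gap is at most (17/16)δ, and 8·(16/17)² > 7. A fraction 7/8 of
  -- the expected sightings then gives 49/8 ≥ 6.
  set θ : ℝ := 7 / δ ^ 2 with hθ
  have hθ0 : 0 < θ := by positivity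
  set s_c : ℕ := max (max s_b (2 * M + 1)) ⌈θ⌉₊ with hs_c
  have hbc : s_b ≤ s_c := (le_max_left _ _).trans (le_max_left _ _)
  obtain ⟨s₂, hs₂⟩ := Filter.eventually_atTop.1 ((eventually_log_le (θ + s_c) one_pos).and
    (Filter.eventually_ge_atTop s_c))
  refine ⟨s₂, fun B tie h N htie hr hN hdisc h' hs' hlen j z => ?_⟩
  -- The bootstrap: β ≥ 1 yields log t observations, eventually enough for every estimate to have k
  -- samples. This makes the gap and hence β accurate, which in turn yields θ log t observations.
  have obs_log : ∀ h'', h'' <:+ h → s_b ≤ h''.length →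
      Real.log h''.length ≤ S.effPulls obsArm h'' := by
    intro h'' hs'' hl
    obtain ⟨h1, -, -, h4, -⟩ := hs_b _ hl
    have hL := Real.log_natCast_nonneg h''.length
    have h5 := min_le_effPulls_obs htie zero_le_one le_rfl
      (by push_cast; linarith [(Nat.cast_nonneg M : (0 : ℝ) ≤ M)]) (hr.suffix hs'')
      (fun t ht _ => one_le_pow₀ (((hr.suffix hs'').suffix ht).one_le_beta hγ hM))
      (by omega : 2 * M + 1 ≤ h''.length)
    rw [one_mul, min_eq_right] at h5
    · exact h5
    · push_cast
      have hM0 : (0 : ℝ) ≤ M := Nat.cast_nonneg M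
      nlinarith [sq_nonneg (Real.log h''.length)]
  have obs_k : ∀ h'', h'' <:+ h → s_b ≤ h''.length → k ≤ S.effPulls obsArm h'' := by
    intro h'' hs'' hl
    have := (hs_b _ hl).2.1.trans (obs_log h'' hs'' hl)
    exact_mod_cast this
  have hbeta : ∀ h'', h'' <:+ h → s_b ≤ h''.length → θ ≤ S.beta γ h'' ^ 2 := by
    intro h'' hs'' hl
    obtain ⟨-, -, h3, h4, h5⟩ := hs_b _ hl
    have hpos := effPulls_pos htie (hr.suffix hs'') (by omega : 2 * M + 1 ≤ h''.length)
    have a0 := abs_sub_le_of_discrepancy_lt hN hdisc hs'' (hpos obsArm) (obs_k h'' hs'' hl)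
    have a1 : ∀ j z, |S.muHat (intArm j z) h'' - S.mu (intArm j z)| ≤ δ / 32 := by
      intro j z
      refine abs_sub_le_of_discrepancy_lt hN hdisc hs'' (hpos _) ?_
      have h6 := obsCount_ge_of_discrepancy_lt hN hdisc hs'' j z (obs_k h'' hs'' hl)
      have h7 := h5 (j, z)
      have hpj := hp j z
      rw [div_le_iff₀ (by positivity)] at h7
      have h8 := mul_le_mul_of_nonneg_left (obs_log h'' hs'' hl)
        (by positivity : 0 ≤ 7 / 8 * S.p j z)
      have h9 : (k : ℝ) ≤ S.obsCount j z h'' := by linarith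
      rw [effPulls_int]
      have h10 : k ≤ S.obsCount j z h'' := by exact_mod_cast h9
      omega
    have g1 := gap_ge (S := S) (h := h'') (i := i) (x := x) hγ (by positivity : 0 ≤ δ / 32)
      (by linarith [(abs_le.1 a0).2]) (by linarith [(abs_le.1 (a1 i x)).1])
    have g2 := gap_le (S := S) (h := h'') hγ hopt (by positivity : 0 ≤ δ / 32)
      (by linarith [(abs_le.1 a0).1]) (fun j z => by linarith [(abs_le.1 (a1 j z)).2])
    rw [← hδ] at g1 g2
    have h6 := le_beta_sq_of_gap (S := S) (γ := γ) (h := h'') h4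
      (by linarith : 0 < δ - 2 * (δ / 32)) g1
      (by linarith : S.muHatMax h'' / γ - S.muHat obsArm h'' ≤ 17 / 16 * δ) h3
    refine le_trans ?_ h6
    rw [hθ, mul_pow, div_le_div_iff₀ (by positivity) (by positivity)]
    have : 0 < δ ^ 2 := by positivity
    nlinarith
  obtain ⟨h1, h2⟩ := hs₂ _ hlen
  have hL := Real.log_natCast_nonneg h'.length
  have h3 := min_le_effPulls_obs htie hθ0.le
    (by omega : 2 * M + 1 ≤ s_c) ((Nat.le_ceil θ).trans (by exact_mod_cast le_max_right _ _))
    (hr.suffix hs') (fun t ht hl => hbeta t (ht.trans hs') (hbc.trans hl)) h2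
  have hsc0 : (0 : ℝ) ≤ s_c := Nat.cast_nonneg _
  rw [min_eq_right (by nlinarith [sq_nonneg (Real.log h'.length)])] at h3
  have h4 := obsCount_ge_of_discrepancy_lt hN hdisc hs' j z (obs_k h' hs' (hbc.trans h2))
  refine le_trans ?_ h4
  have hpj := hp j z
  have h5 := mul_le_mul_of_nonneg_left h3 (by positivity : 0 ≤ 7 / 8 * S.p j z)
  refine le_trans ?_ h5
  have e1 : 7 / 8 * S.p j z * (θ * Real.log h'.length) =
      49 / 8 * (S.p j z / δ ^ 2 * Real.log h'.length) := by
    rw [hθ]; ring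
  have e2 : 6 * S.p j z / δ ^ 2 * Real.log h'.length =
      6 * (S.p j z / δ ^ 2 * Real.log h'.length) := by ring
  rw [e1, e2]
  have : 0 ≤ S.p j z / δ ^ 2 * Real.log h'.length := by positivity
  linarith

/-- The number of pulls of a suboptimal intervention if some intervention is optimal. -/
theorem exists_expect_pulls_int_le (S : NBModel V M) (hγ : 1 ≤ γ) {i : Fin M} {x : Fin 2}
    (hopt : ∀ a, S.v γ a ≤ S.v γ (intArm i x)) (hd : 0 < S.d γ (intArm i x) obsArm)
    {j : Fin M} {z : Fin 2} (hdj : 0 < S.d γ (intArm i x) (intArm j z)) {η : ℝ} (hη : 0 < η) :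
    ∃ C, ∀ B, 1 + 2 * M * γ ≤ B → ∀ tie, IsSelection tie →
      S.expect (S.crmNB γ B tie) (fun h => (pulls (intArm j z) h : ℝ)) ⌊B⌋₊ [] ≤
        C + 18 * Real.log B * max 0 (1 / S.d γ (intArm i x) (intArm j z) ^ 2 -
          S.p j z / (3 * S.d γ (intArm i x) obsArm ^ 2)) + η * Real.log B := by
  set δ := S.d γ (intArm i x) obsArm with hδ
  set δ' := S.d γ (intArm i x) (intArm j z) with hδ'
  -- The weight is chosen so that its product with the crude bound `m₂` below is η log B.
  obtain ⟨k, hk⟩ := S.exists_expect_discrepancy_le (by positivity : 0 < δ / 32)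
    (by positivity : 0 < η * δ' ^ 2 / 18)
  obtain ⟨s₂, hs₂⟩ := S.exists_obsCount_ge hγ hopt hd k
  set s₁ := max s₂ (2 * M + 1) with hs₁
  refine ⟨s₁ + 1 + ∑' s : ℕ, 32 * (2 * (M : ℝ) + 1) * (1 / (s : ℝ) ^ 2),
    fun B hB tie htie => ?_⟩
  have hw := crmNB_withinBudget (S := S) hγ hB htie
  have hB1 : 1 ≤ B := by
    have : 0 ≤ 2 * M * γ := by positivity
    linarith
  have hLB := Real.log_nonneg hB1
  set ρ := 1 / δ' ^ 2 - S.p j z / (3 * δ ^ 2) with hρ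
  -- `m₁` bounds the pulls when the seen values use up part of the quota, 6 = 18/3 being the source
  -- of p/(3δ²). `m₂` is the full quota, used when the discrepancy is at least 1.
  set m₁ := 18 * Real.log B * max 0 ρ with hm₁
  set m₂ := 18 * Real.log B / δ' ^ 2 with hm₂
  have hm₁0 : 0 ≤ m₁ := by positivity
  have hm₂0 : 0 ≤ m₂ := by positivity
  have hmain := expect_le_of_pathwise (S := S) (π := S.crmNB γ B tie) (N := ⌊B⌋₊)
    (f := fun h => (pulls (intArm j z) h : ℝ)) (w := fun s h => S.badness s h)
    (c := s₁ + 1 + m₁) (g := fun h => m₂ * S.discrepancy (δ / 32) k ⌊B⌋₊ h)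
    badness_nonneg (summable_badness_bound M) (fun s => expect_badness_le _ _)
    (fun h hr => hw.length_le hγ hr) (fun h hf => ?_)
  · rw [expect_mul_left] at hmain
    have h1 := mul_le_mul_of_nonneg_left (hk (S.crmNB γ B tie) ⌊B⌋₊) hm₂0
    have h2 : m₂ * (η * δ' ^ 2 / 18) = η * Real.log B := by
      rw [hm₂]
      field_simp
    linarith
  · have few : ∀ e h', e :: h' <:+ h → e.1 = intArm j z → s₁ ≤ h'.length →
        S.badness h'.length h < 1 →
        (pulls (intArm j z) h' : ℝ) + S.obsCount j z h' ≤ 18 * Real.log h'.length / δ' ^ 2 ∧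
          Real.log h'.length ≤ Real.log B := by
      intro e h' hs he hlen hb
      have hs' : h' <:+ h := (List.suffix_cons e h').trans hs
      have hM : 2 * M + 1 ≤ h'.length := (le_max_right _ _).trans hlen
      have hacc := accurate_of_badness_lt htie hf.1 hs' hM (by omega) le_rfl hb
      have hpos := effPulls_pos htie (hf.1.suffix hs') hM (intArm j z)
      have hne : e.1 ≠ obsArm := by rw [he]; simp
      constructor
      · rcases (step_cases htie (hf.1.suffix hs) hM).2 with ⟨ho, -⟩ | ⟨ho, -⟩ | ⟨-, -, hucb⟩
        · exact absurd ho hne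
        · exact absurd ho hne
        · rw [he] at hucb
          have h1 := hacc.effPulls_le hγ (hopt _) hpos (hucb (intArm i x))
          rw [show armCost γ (intArm j z) = γ from if_neg (by simp), ← hδ', effPulls_int] at h1
          push_cast at h1
          rw [le_div_iff₀ (by positivity)]
          refine le_trans ?_ h1
          rw [mul_comm, mul_pow]
          have : 1 ≤ γ ^ 2 := one_le_pow₀ hγ
          gcongr
          exact le_mul_of_one_le_left (sq_nonneg _) this
      · have h1 := (hs'.length_le).trans (hw.length_le hγ hf.1)
        refine Real.log_le_log (by exact_mod_cast (by omega : 0 < h'.length)) ?_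
        exact (Nat.cast_le.2 h1).trans (Nat.floor_le (by linarith))
    have split : ∀ m : ℝ, 0 ≤ m → (∀ e h', e :: h' <:+ h → e.1 = intArm j z →
        s₁ ≤ h'.length → S.badness h'.length h < 1 → (pulls (intArm j z) h' : ℝ) ≤ m) →
        (pulls (intArm j z) h : ℝ) ≤ s₁ + 1 + m +
          ∑ s ∈ Finset.range h.length, S.badness s h := by
      intro m hm H
      have b1 : (occ (fun e h' => e.1 = intArm j z ∧ (pulls (intArm j z) h' : ℝ) ≤ m) h : ℝ) ≤
          m + 1 := by
        refine occ_le_add_one hm fun e h' _ hP => le_trans ?_ hP.2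
        have : occ (fun e h' => e.1 = intArm j z ∧ (pulls (intArm j z) h' : ℝ) ≤ m) h' ≤
          pulls (intArm j z) h' := occ_le_of_imp fun _ _ _ h => h.1
        exact_mod_cast this
      have b2 : (occ (fun e h' => e.1 = intArm j z ∧ m < (pulls (intArm j z) h' : ℝ)) h : ℝ) ≤
          s₁ + ∑ s ∈ Finset.range h.length, S.badness s h := by
        refine occ_le_add_sum (fun s => badness_nonneg _ _) s₁ fun e h' hs he hlen => ?_
        by_contra hlt
        exact absurd (H e h' hs he.1 hlen (not_le.1 hlt)) (not_le.2 he.2)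
      have b3 : pulls (intArm j z) h ≤
          occ (fun e h' => e.1 = intArm j z ∧ (pulls (intArm j z) h' : ℝ) ≤ m) h +
          occ (fun e h' => e.1 = intArm j z ∧ m < (pulls (intArm j z) h' : ℝ)) h :=
        occ_le_add fun e h' _ he => (le_or_gt (pulls (intArm j z) h' : ℝ) m).imp
          (fun h => ⟨he, h⟩) (fun h => ⟨he, h⟩)
      have b3' : (pulls (intArm j z) h : ℝ) ≤
          occ (fun e h' => e.1 = intArm j z ∧ (pulls (intArm j z) h' : ℝ) ≤ m) h +
          occ (fun e h' => e.1 = intArm j z ∧ m < (pulls (intArm j z) h' : ℝ)) h := by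
        exact_mod_cast b3
      linarith
    by_cases hdisc : S.discrepancy (δ / 32) k ⌊B⌋₊ h < 1
    · have h1 := split m₁ hm₁0 fun e h' hs he hlen hb => by
        obtain ⟨h2, h3⟩ := few e h' hs he hlen hb
        have h4 := hs₂ B tie h ⌊B⌋₊ htie hf.1 (hw.length_le hγ hf.1) hdisc h'
          ((List.suffix_cons e h').trans hs) ((le_max_left _ _).trans hlen) j z
        have hL := Real.log_natCast_nonneg h'.length
        have e1 : 18 * Real.log h'.length / δ' ^ 2 - 6 * S.p j z / δ ^ 2 * Real.log h'.length =
            18 * Real.log h'.length * ρ := by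
          rw [hρ]
          field_simp
          ring
        calc (pulls (intArm j z) h' : ℝ) ≤ 18 * Real.log h'.length * ρ := by linarith
          _ ≤ 18 * Real.log h'.length * max 0 ρ := by
            gcongr
            exact le_max_right _ _
          _ ≤ m₁ := by
            rw [hm₁]
            gcongr
      have := mul_nonneg hm₂0 (discrepancy_nonneg (S := S) (δ / 32) k ⌊B⌋₊ h)
      linarith
    · have h1 := split m₂ hm₂0 fun e h' hs he hlen hb => by
        obtain ⟨h2, h3⟩ := few e h' hs he hlen hb
        have h4 : (0 : ℝ) ≤ S.obsCount j z h' := Nat.cast_nonneg _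
        calc (pulls (intArm j z) h' : ℝ) ≤ 18 * Real.log h'.length / δ' ^ 2 := by linarith
          _ ≤ m₂ := by
            rw [hm₂]
            gcongr
      have := mul_le_mul_of_nonneg_left (not_lt.1 hdisc) hm₂0
      linarith

end

/-! ### Assembling the regret bounds -/

section

theorem exists_abs_regret_le_of_obs_opt {V : Type} [Fintype V] [DecidableEq V]
    {M : ℕ} (S : NBModel V M) {γ : ℝ} (hγ : 1 ≤ γ)
    (hopt : ∀ a : Arm M, S.v γ a ≤ S.v γ obsArm) :
    ∃ C : ℝ, ∀ B : ℝ, 1 + 2 * M * γ ≤ B →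
      ∀ tie : History V M → Finset (Arm M) → Arm M,
        IsSelection tie → |S.regret γ B (S.crmNB γ B tie)| ≤ C := by
  have key : ∀ a : Arm M, ∃ C : ℝ, ∀ B : ℝ, 1 + 2 * M * γ ≤ B →
      ∀ tie, IsSelection tie →
      armCost γ a * S.d γ obsArm a * S.expect (S.crmNB γ B tie)
        (fun h => (pulls a h : ℝ)) ⌊B⌋₊ [] ≤ C := by
    intro a
    rcases (sub_nonneg.2 (hopt a)).eq_or_lt with h0 | hpos
    · refine ⟨0, fun B _ tie _ => ?_⟩
      rw [d, ← h0]
      simp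
    · rcases a with _ | ⟨i, x⟩
      · simp at hpos
      · obtain ⟨C, hC⟩ := S.exists_expect_pulls_le hγ hopt i x hpos
        exact ⟨_, fun B hB tie htie => mul_le_mul_of_nonneg_left (hC B hB tie htie)
          (mul_nonneg (armCost_pos hγ _).le hpos.le)⟩
  choose C hC using key
  exact ⟨1 + ∑ a, C a, fun B hB tie htie =>
    (abs_regret_le hγ hopt hB htie).trans
      (add_le_add_right (Finset.sum_le_sum fun a _ => hC a B hB tie htie) 1)⟩

theorem exists_abs_regret_le_of_int_opt {V : Type} [Fintype V] [DecidableEq V]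
    {M : ℕ} (S : NBModel V M) {γ : ℝ} (hγ : 1 ≤ γ) {i : Fin M} {x : Fin 2}
    {aStar : Arm M} (haStar : aStar = intArm i x)
    (hopt : ∀ a : Arm M, S.v γ a ≤ S.v γ aStar)
    (hlt : S.v γ obsArm < S.v γ aStar) :
    ∃ B₀ : ℝ, ∀ B : ℝ, B₀ ≤ B →
      ∀ tie : History V M → Finset (Arm M) → Arm M,
        IsSelection tie →
        |S.regret γ B (S.crmNB γ B tie)| ≤ 3 * S.regretBound γ aStar B := by
  classical
  have hγ0 : 0 < γ := by linarith
  obtain ⟨δ, hδ⟩ : ∃ δ, δ = S.d γ aStar obsArm := ⟨_, rfl⟩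
  have hδ0 : 0 < δ := hδ ▸ sub_pos.2 hlt
  obtain ⟨Δ₀, hΔ₀⟩ : ∃ Δ₀, Δ₀ = S.Delta aStar obsArm := ⟨_, rfl⟩
  -- An observation costs δ in the regret decomposition, while the bound is stated with Δ_0;
  -- dividing μ_{a*} by γ ≥ 1 only shrinks the difference.
  have hΔδ : δ ≤ Δ₀ := by
    rw [hδ, hΔ₀, d, Delta,
      v_obs, haStar, v_int]
    linarith [div_le_self (S.mu_nonneg (intArm i x)) hγ]
  have hΔ₀0 : 0 < Δ₀ := hδ0.trans_le hΔδ
  have hDelta : ∀ j z, S.Delta aStar (intArm j z) =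
      γ * S.d γ aStar (intArm j z) := by
    intro j z
    rw [d, Delta, haStar, v_int,
      v_int]
    field_simp
  have hd0 : ∀ a, 0 ≤ S.d γ aStar a := fun a => sub_nonneg.2 (hopt a)
  obtain ⟨K, hK⟩ : ∃ K, K = ∑ jz : Fin M × Fin 2, S.Delta aStar (intArm jz.1 jz.2) := ⟨_, rfl⟩
  have hK0 : 0 ≤ K := hK ▸ Finset.sum_nonneg fun jz _ => by
    rw [hDelta]
    exact mul_nonneg hγ0.le (hd0 _)
  -- The exceptional events of all interventions together may cost at most one unit of Δ_0 log B /
  -- δ²; `K + 1` avoids dividing by 0.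
  obtain ⟨η, hη0, hηK⟩ : ∃ η : ℝ, 0 < η ∧ η * K ≤ Δ₀ / δ ^ 2 := by
    refine ⟨Δ₀ / (δ ^ 2 * (K + 1)), by positivity, ?_⟩
    rw [div_mul_eq_mul_div, div_le_div_iff₀ (by positivity) (by positivity)]
    have : 0 < Δ₀ * δ ^ 2 := by positivity
    nlinarith
  obtain ⟨C₀, hC₀⟩ : ∃ C, ∀ B, 1 + 2 * M * γ ≤ B → ∀ tie, IsSelection tie →
      S.expect (S.crmNB γ B tie) (fun h => (pulls obsArm h : ℝ)) ⌊B⌋₊ [] ≤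
        C + 32 * Real.log B / δ ^ 2 := by
    subst haStar
    rw [hδ] at hδ0 ⊢
    exact S.exists_expect_pulls_obs_le hγ hopt hδ0
  have key : ∀ jz : Fin M × Fin 2, ∃ C : ℝ, ∀ B : ℝ, 1 + 2 * M * γ ≤ B →
      ∀ tie, IsSelection tie →
      γ * S.d γ aStar (intArm jz.1 jz.2) * S.expect (S.crmNB γ B tie)
        (fun h => (pulls (intArm jz.1 jz.2) h : ℝ)) ⌊B⌋₊ [] ≤
      C + S.Delta aStar (intArm jz.1 jz.2) * (18 * Real.log B * max 0
          (1 / S.d γ aStar (intArm jz.1 jz.2) ^ 2 - S.p jz.1 jz.2 / (3 * δ ^ 2))) +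
        η * S.Delta aStar (intArm jz.1 jz.2) * Real.log B := by
    intro jz
    rw [hDelta]
    rcases (hd0 (intArm jz.1 jz.2)).eq_or_lt with h0 | hpos
    · refine ⟨0, fun B _ tie _ => ?_⟩
      rw [← h0]
      simp
    · obtain ⟨C, hC⟩ : ∃ C, ∀ B, 1 + 2 * M * γ ≤ B → ∀ tie, IsSelection tie →
          S.expect (S.crmNB γ B tie) (fun h => (pulls (intArm jz.1 jz.2) h : ℝ)) ⌊B⌋₊ [] ≤
            C + 18 * Real.log B * max 0 (1 / S.d γ aStar (intArm jz.1 jz.2) ^ 2 -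
              S.p jz.1 jz.2 / (3 * δ ^ 2)) + η * Real.log B := by
        subst haStar
        rw [hδ] at hδ0 ⊢
        exact S.exists_expect_pulls_int_le hγ hopt hδ0 hpos hη0
      refine ⟨γ * S.d γ aStar (intArm jz.1 jz.2) * C, fun B hB tie htie =>
        (mul_le_mul_of_nonneg_left (hC B hB tie htie) (by positivity)).trans (le_of_eq ?_)⟩
      ring
  choose C hC using key
  obtain ⟨D, hD⟩ : ∃ D, D = 1 + δ * C₀ + ∑ jz, C jz := ⟨_, rfl⟩
  -- From `B₀` on, all constants independent of B also fit into one such unit.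
  have hlim : ∀ᶠ B : ℝ in Filter.atTop, D / (Δ₀ / δ ^ 2) ≤ Real.log B :=
    Real.tendsto_log_atTop.eventually_ge_atTop _
  obtain ⟨B₀, hB₀⟩ := Filter.eventually_atTop.1
    (hlim.and (Filter.eventually_ge_atTop (1 + 2 * M * γ)))
  refine ⟨B₀, fun B hB tie htie => ?_⟩
  obtain ⟨hlog, hB1⟩ := hB₀ B hB
  have hL : 0 ≤ Real.log B := Real.log_nonneg (by
    have : 0 ≤ 2 * M * γ := by positivity
    linarith)
  rw [div_le_iff₀ (by positivity)] at hlog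
  have hreg := abs_regret_le (S := S) hγ hopt hB1 htie
  rw [Fintype.sum_option] at hreg
  have hobs : armCost γ (none : Arm M) * S.d γ aStar none *
      S.expect (S.crmNB γ B tie) (fun h => (pulls none h : ℝ)) ⌊B⌋₊ [] ≤
      δ * C₀ + Δ₀ * (32 * Real.log B / δ ^ 2) := by
    rw [show armCost γ (none : Arm M) = 1 from if_pos rfl, one_mul,
      show S.d γ aStar none = δ from hδ.symm]
    have h1 := mul_le_mul_of_nonneg_left (hC₀ B hB1 tie htie) hδ0.le
    have h2 : δ * (32 * Real.log B / δ ^ 2) ≤ Δ₀ * (32 * Real.log B / δ ^ 2) :=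
      mul_le_mul_of_nonneg_right hΔδ (by positivity)
    refine h1.trans ?_
    rw [mul_add]
    linarith
  have hint : ∑ jz : Fin M × Fin 2, armCost γ (some jz) * S.d γ aStar (some jz) *
      S.expect (S.crmNB γ B tie) (fun h => (pulls (some jz) h : ℝ)) ⌊B⌋₊ [] ≤
      ∑ jz, C jz + (∑ jz : Fin M × Fin 2, S.Delta aStar (intArm jz.1 jz.2) *
        (18 * Real.log B * max 0 (1 / S.d γ aStar (intArm jz.1 jz.2) ^ 2 -
          S.p jz.1 jz.2 / (3 * δ ^ 2)))) + η * K * Real.log B := by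
    rw [hK, Finset.mul_sum, Finset.sum_mul, ← Finset.sum_add_distrib, ← Finset.sum_add_distrib]
    refine Finset.sum_le_sum fun jz _ => ?_
    rw [show armCost γ (some jz : Arm M) = γ from if_neg (by simp)]
    exact hC jz B hB1 tie htie
  have hmax : ∑ jz : Fin M × Fin 2, S.Delta aStar (intArm jz.1 jz.2) *
        (18 * Real.log B * max 0 (1 / S.d γ aStar (intArm jz.1 jz.2) ^ 2 -
          S.p jz.1 jz.2 / (3 * δ ^ 2))) ≤
      3 * ∑ jz : Fin M × Fin 2 with 0 < S.Delta aStar (intArm jz.1 jz.2),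
        S.Delta aStar (intArm jz.1 jz.2) *
        (max 0 (1 + 8 * Real.log B *
            (1 / S.d γ aStar (intArm jz.1 jz.2) ^ 2 -
              S.p jz.1 jz.2 / (3 * δ ^ 2))) + Real.pi ^ 2 / 3) := by
    rw [Finset.mul_sum, Finset.sum_filter]
    refine Finset.sum_le_sum fun jz _ => ?_
    split_ifs with hpos
    · generalize 1 / S.d γ aStar (intArm jz.1 jz.2) ^ 2 - S.p jz.1 jz.2 / (3 * δ ^ 2) = y
      -- Here the factor 3 is used: 18 ≤ 3·8.
      have h1 : 18 * Real.log B * max 0 y ≤ 3 * max 0 (1 + 8 * Real.log B * y) := by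
        rcases le_total y 0 with hy | hy
        · rw [max_eq_left hy, mul_zero]
          positivity
        · rw [max_eq_right hy]
          have h2 := le_max_right 0 (1 + 8 * Real.log B * y)
          have h3 : 0 ≤ Real.log B * y := mul_nonneg hL hy
          nlinarith
      have h2 := mul_le_mul_of_nonneg_left h1 hpos.le
      have h3 : 0 ≤ S.Delta aStar (intArm jz.1 jz.2) * (Real.pi ^ 2 / 3) := by
        positivity
      rw [mul_add]
      linarith
    · have h0 : S.Delta aStar (intArm jz.1 jz.2) = 0 := by
        refine le_antisymm (not_lt.1 hpos) ?_
        rw [hDelta]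
        exact mul_nonneg hγ0.le (hd0 _)
      rw [h0, zero_mul]
  have hlast : η * K * Real.log B ≤ Δ₀ / δ ^ 2 * Real.log B := mul_le_mul_of_nonneg_right hηK hL
  have hpi : 0 ≤ Δ₀ * (1 + Real.pi ^ 2 / 3) := by positivity
  have hX : 0 ≤ Real.log B * (Δ₀ / δ ^ 2) := by positivity
  have e1 : Δ₀ * (32 * Real.log B / δ ^ 2) = 32 * (Real.log B * (Δ₀ / δ ^ 2)) := by ring
  have e2 : Δ₀ * (50 * Real.log B / δ ^ 2 + 1 + Real.pi ^ 2 / 3) =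
      50 * (Real.log B * (Δ₀ / δ ^ 2)) + Δ₀ * (1 + Real.pi ^ 2 / 3) := by ring
  -- In units of Δ_0 log B / δ², the observations take 32, the exceptional events 1 and the
  -- constants 1, within the available 3·50.
  rw [regretBound, ← hδ, ← hΔ₀, e2]
  rw [e1] at hobs
  linarith

end

end NBModel

end CausalBandit

end

theorem theorem3 :
    -- the observational arm is optimal: the regret is bounded in the budget
    (∀ (V : Type) [Fintype V] [DecidableEq V] (M : ℕ) (S : CausalBandit.NBModel V M) (γ : ℝ),
      1 ≤ γ →
      (∀ a : CausalBandit.Arm M, S.v γ a ≤ S.v γ CausalBandit.obsArm) →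
      ∃ C : ℝ, ∀ B : ℝ, 1 + 2 * M * γ ≤ B →
        ∀ tie : CausalBandit.History V M → Finset (CausalBandit.Arm M) → CausalBandit.Arm M,
          CausalBandit.IsSelection tie →
          |S.regret γ B (S.crmNB γ B tie)| ≤ C) ∧
    -- otherwise: the logarithmic bound, up to an absolute constant, for all large budgets
    (∃ C : ℝ, 0 < C ∧
      ∀ (V : Type) [Fintype V] [DecidableEq V] (M : ℕ) (S : CausalBandit.NBModel V M) (γ : ℝ),
      1 ≤ γ →
      ∀ aStar : CausalBandit.Arm M,
      (∀ a : CausalBandit.Arm M, S.v γ a ≤ S.v γ aStar) →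
      S.v γ CausalBandit.obsArm < S.v γ aStar →
      ∃ B₀ : ℝ, ∀ B : ℝ, B₀ ≤ B →
        ∀ tie : CausalBandit.History V M → Finset (CausalBandit.Arm M) → CausalBandit.Arm M,
          CausalBandit.IsSelection tie →
          |S.regret γ B (S.crmNB γ B tie)| ≤ C * S.regretBound γ aStar B) := by
  refine ⟨fun V _ _ M S γ hγ hopt => S.exists_abs_regret_le_of_obs_opt hγ hopt, 3, by norm_num,
    fun V _ _ M S γ hγ aStar hopt hlt => ?_⟩
  rcases aStar with _ | ⟨i, x⟩
  · exact absurd hlt (lt_irrefl _)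
  · exact S.exists_abs_regret_le_of_int_opt hγ rfl hopt hlt
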